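/- Let $\mathcal N$ be a finite ground set with $n$ elements. A function $f\colon 2^{\mathcal N}\to\mathbb R_{\ge 0}$ is *submodular* if $f(S\cup\{u\})-f(S)\ge f(T\cup\{u\})-f(T)$ for all $S\subseteq T\subseteq\mathcal N$ and $u\notin T$, and *symmetric* if $f(S)=f(\mathcal N\setminus S)$ for all $S$. Its *multilinear extension* is $F(x)=\sum_{S\subseteq\mathcal N}f(S)\prod_{u\in S}x_u\prod_{u\notin S}(1-x_u)$ for $x\in[0,1]^{\mathcal N}$. A knapsack constraint is given by costs $p\in\mathbb R_{\ge0}^{\mathcal N}$ and a budget $B\ge 0$; its polytope is $\mathcal P=\{x\in[0,1]^{\mathcal N}: \langle p,x\rangle\le B\}$ and its density is $c=B/\|p\|_1$, which is assumed to lie in $(0,1)$. **Theorem.** For every constant $\varepsilon\in(0,1/2]$ there is a polynomial-time $\bigl(\tfrac12-\varepsilon-o(1),\ \tfrac{1-(2\varepsilon)^c}{2c}\bigr)$-bicriteria integer-approximation algorithm for maximizing the multilinear extension of a non-negative symmetric submodular function over the polytope of a knapsack constraint of density $c$. Explicitly: for every $\varepsilon\in(0,1/2]$ there are a randomized algorithm,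 a polynomial $q$ and a sequence $\mathrm{err}(n)\to0$ (all depending only on $\varepsilon$) such that on every instance as above the algorithm, given $n$, $p$, $B$, (the constant $\varepsilon$) and a value oracle for $f$, always halts within $q(n)$ steps and outputs a vector $x\in[0,1]^{\mathcal N}$ with the following properties. Write $\beta=\tfrac{1-(2\varepsilon)^c}{2c}$, and let $\mathrm{OPT}$ be a set of maximum $f$-value among all $S\subseteq\mathcal N$ with $\mathbf 1_S\in\mathcal P$. 1. For every outcome of the random coins there are $y_1,y_2\in\mathcal P$ with $y_1\le x\le\beta y_2$ (coordinate-wise). 2. $\mathbb E[F(x)]\ge\bigl(\tfrac12-\varepsilon-\mathrm{err}(n)\bigr)\cdot f(\mathrm{OPT})$, where the expectation is over the coins of the algorithm. Here a step is an elementary operation of a randomized random access machine with real-valued memory: an arithmetic operation ($+,-,\times,/$) or comparison on real numbers, an addition, subtraction or comparison of natural-number counters/indices, a memory access, a fair coin flip, or a query to the value oracle of $f$. The program is a single finite text (independent of $n$) whose only constants are rational numbers and $\varepsilon$. -/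

import Mathlib

open scoped BigOperators

noncomputable section

/-! ### Set functions, multilinear extension, knapsack polytopes -/

/-- Submodularity: diminishing marginal contributions. -/
def IsSubmodular {n : ℕ} (f : Finset (Fin n) → ℝ) : Prop :=
  ∀ S T : Finset (Fin n), S ⊆ T → ∀ u, u ∉ T →
    f (insert u T) - f T ≤ f (insert u S) - f S

/-- Symmetry: a set and its complement have the same value. -/
def IsSymmetricSetFun {n : ℕ} (f : Finset (Fin n) → ℝ) : Prop :=
  ∀ S : Finset (Fin n), f Sᶜ = f S

/-- The multilinear extension: the expected value of `f` on the random set that contains every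
element `u` independently with probability `x u`. -/
def multilinearExt {n : ℕ} (f : Finset (Fin n) → ℝ) (x : Fin n → ℝ) : ℝ :=
  ∑ S : Finset (Fin n), f S * (∏ u ∈ S, x u) * ∏ u ∈ Sᶜ, (1 - x u)

/-- The characteristic vector of a set. -/
def charVec {n : ℕ} (S : Finset (Fin n)) : Fin n → ℝ := fun u => if u ∈ S then 1 else 0

/-- The polytope of the knapsack constraint with costs `p` and budget `B`. -/
def knapsackPolytope {n : ℕ} (p : Fin n → ℝ) (B : ℝ) : Set (Fin n → ℝ) :=
  {x | (∀ u, 0 ≤ x u ∧ x u ≤ 1) ∧ ∑ u, p u * x u ≤ B}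

/-- The density `B / ‖p‖₁` of a knapsack constraint. -/
def density {n : ℕ} (p : Fin n → ℝ) (B : ℝ) : ℝ := B / ∑ u, |p u|

/-- `O` is a best integral solution over `P`: it is feasible and has maximum value among all sets
whose characteristic vectors belong to `P`. -/
def IsIntegralOpt {n : ℕ} (f : Finset (Fin n) → ℝ) (P : Set (Fin n → ℝ))
    (O : Finset (Fin n)) : Prop :=
  charVec O ∈ P ∧ ∀ S : Finset (Fin n), charVec S ∈ P → f S ≤ f O

/-- The vectors of `[0, 1]^n` that are feasible for `P` up to infeasibility ratio `β`. -/
def bicriteriaFeasible {n : ℕ} (P : Set (Fin n → ℝ)) (β : ℝ) : Set (Fin n → ℝ) :=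
  {x | (∀ u, 0 ≤ x u ∧ x u ≤ 1) ∧ ∃ y₁ ∈ P, ∃ y₂ ∈ P, y₁ ≤ x ∧ x ≤ β • y₂}

/-! ### A randomized real RAM with a value oracle

A program is a finite text over natural-number registers (used as counters and array indices) and
arrays of real numbers. It contains only rational constants. Its primitive operations are addition
and truncated subtraction of naturals, the four arithmetic operations and comparison on reals,
a query to the value oracle, and a fair coin flip. There is no rounding operation that turns
a real into a natural number. -/

namespace OracleRAM

/-- Expressions for natural numbers. -/
inductive NatExpr where
  | const (k : ℕ)
  | reg (i : ℕ)
  | add (e₁ e₂ : NatExpr)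
  | sub (e₁ e₂ : NatExpr)

/-- Expressions for real numbers; `cell a e` is the entry of array `a` at index `e`. -/
inductive RealExpr where
  | const (q : ℚ)
  | cell (a : ℕ) (e : NatExpr)
  | cast (e : NatExpr)
  | add (e₁ e₂ : RealExpr)
  | sub (e₁ e₂ : RealExpr)
  | mul (e₁ e₂ : RealExpr)
  | div (e₁ e₂ : RealExpr)

/-- Tests. -/
inductive Cond where
  | natLE (e₁ e₂ : NatExpr)
  | realLE (e₁ e₂ : RealExpr)
  | not (b : Cond)
  | and (b₁ b₂ : Cond)

/-- Programs.
* `setNat i e` stores the value of `e` in the natural register `i`;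
* `setReal a i e` stores the value of `e` in array `a` at index `i`;
* `query src a i` stores in array `a` at index `i` the oracle's value of the set whose elements are
  marked by the entries `1` of array `src`;
* `flip a i` stores a fair random bit (as `0` or `1`) in array `a` at index `i`. -/
inductive Prog where
  | skip
  | setNat (i : ℕ) (e : NatExpr)
  | setReal (a : ℕ) (i : NatExpr) (e : RealExpr)
  | query (src : ℕ) (a : ℕ) (i : NatExpr)
  | flip (a : ℕ) (i : NatExpr)
  | seq (P Q : Prog)
  | ite (b : Cond) (P Q : Prog)
  | loop (b : Cond) (P : Prog)

/-- A memory state: natural registers, real arrays, and the number of coins flipped so far. -/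
structure State where
  nat : ℕ → ℕ
  real : ℕ → ℕ → ℝ
  coins : ℕ

/-- Store a natural number in a register. -/
def State.putNat (s : State) (i v : ℕ) : State :=
  { s with nat := Function.update s.nat i v }

/-- Store a real number in an array. -/
def State.putReal (s : State) (a i : ℕ) (v : ℝ) : State :=
  { s with real := Function.update s.real a (Function.update (s.real a) i v) }

def NatExpr.eval (s : State) : NatExpr → ℕ
  | .const k => k
  | .reg i => s.nat i
  | .add e₁ e₂ => e₁.eval s + e₂.eval s
  | .sub e₁ e₂ => e₁.eval s - e₂.eval s

def RealExpr.eval (s : State) : RealExpr → ℝ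
  | .const q => (q : ℝ)
  | .cell a e => s.real a (e.eval s)
  | .cast e => (e.eval s : ℝ)
  | .add e₁ e₂ => e₁.eval s + e₂.eval s
  | .sub e₁ e₂ => e₁.eval s - e₂.eval s
  | .mul e₁ e₂ => e₁.eval s * e₂.eval s
  | .div e₁ e₂ => e₁.eval s / e₂.eval s

def Cond.holds (s : State) : Cond → Prop
  | .natLE e₁ e₂ => e₁.eval s ≤ e₂.eval s
  | .realLE e₁ e₂ => e₁.eval s ≤ e₂.eval s
  | .not b => ¬ b.holds s
  | .and b₁ b₂ => b₁.holds s ∧ b₂.holds s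

/-- The cost of evaluating an expression or a test is its number of nodes. -/
def NatExpr.cost : NatExpr → ℕ
  | .const _ => 1
  | .reg _ => 1
  | .add e₁ e₂ => e₁.cost + e₂.cost + 1
  | .sub e₁ e₂ => e₁.cost + e₂.cost + 1

def RealExpr.cost : RealExpr → ℕ
  | .const _ => 1
  | .cell _ e => e.cost + 1
  | .cast e => e.cost + 1
  | .add e₁ e₂ => e₁.cost + e₂.cost + 1
  | .sub e₁ e₂ => e₁.cost + e₂.cost + 1
  | .mul e₁ e₂ => e₁.cost + e₂.cost + 1
  | .div e₁ e₂ => e₁.cost + e₂.cost + 1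

def Cond.cost : Cond → ℕ
  | .natLE e₁ e₂ => e₁.cost + e₂.cost + 1
  | .realLE e₁ e₂ => e₁.cost + e₂.cost + 1
  | .not b => b.cost + 1
  | .and b₁ b₂ => b₁.cost + b₂.cost + 1

/-- The set marked by the entries `1` of the array `src`. -/
def State.markedSet (s : State) (n src : ℕ) : Finset (Fin n) :=
  open Classical in Finset.univ.filter fun u : Fin n => s.real src u = 1

/-- `Exec f ω P s t s'`: with value oracle `f` and coin flips `ω 0, ω 1, …`, the program `P` started
in state `s` halts after exactly `t` steps in state `s'`. -/
inductive Exec {n : ℕ} (f : Finset (Fin n) → ℝ) (ω : ℕ → Bool) :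
    Prog → State → ℕ → State → Prop
  | skip (s : State) : Exec f ω .skip s 1 s
  | setNat (s : State) (i : ℕ) (e : NatExpr) :
      Exec f ω (.setNat i e) s (e.cost + 1) (s.putNat i (e.eval s))
  | setReal (s : State) (a : ℕ) (i : NatExpr) (e : RealExpr) :
      Exec f ω (.setReal a i e) s (i.cost + e.cost + 1) (s.putReal a (i.eval s) (e.eval s))
  | query (s : State) (src a : ℕ) (i : NatExpr) :
      Exec f ω (.query src a i) s (i.cost + 1) (s.putReal a (i.eval s) (f (s.markedSet n src)))
  | flip (s : State) (a : ℕ) (i : NatExpr) :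
      Exec f ω (.flip a i) s (i.cost + 1)
        { s.putReal a (i.eval s) (if ω s.coins then 1 else 0) with coins := s.coins + 1 }
  | seq {P Q : Prog} {s s₁ s₂ : State} {t₁ t₂ : ℕ}
      (h₁ : Exec f ω P s t₁ s₁) (h₂ : Exec f ω Q s₁ t₂ s₂) :
      Exec f ω (.seq P Q) s (t₁ + t₂) s₂
  | iteTrue {b : Cond} {P Q : Prog} {s s' : State} {t : ℕ}
      (hb : b.holds s) (h : Exec f ω P s t s') :
      Exec f ω (.ite b P Q) s (b.cost + t) s'
  | iteFalse {b : Cond} {P Q : Prog} {s s' : State} {t : ℕ}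
      (hb : ¬ b.holds s) (h : Exec f ω Q s t s') :
      Exec f ω (.ite b P Q) s (b.cost + t) s'
  | loopTrue {b : Cond} {P : Prog} {s s₁ s₂ : State} {t₁ t₂ : ℕ}
      (hb : b.holds s) (h₁ : Exec f ω P s t₁ s₁) (h₂ : Exec f ω (.loop b P) s₁ t₂ s₂) :
      Exec f ω (.loop b P) s (b.cost + t₁ + t₂) s₂
  | loopFalse {b : Cond} {P : Prog} {s : State}
      (hb : ¬ b.holds s) : Exec f ω (.loop b P) s b.cost s

/-- The initial state: natural register `0` holds the size `n` of the ground set, array `0` holds the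
budget and the constant `ε`, array `1` holds the costs of the elements; all else is `0`. -/
def initState {n : ℕ} (ε : ℝ) (p : Fin n → ℝ) (B : ℝ) : State where
  nat := fun i => if i = 0 then n else 0
  real := fun a i =>
    if a = 0 then (if i = 0 then B else if i = 1 then ε else 0)
    else if a = 1 then (if h : i < n then p ⟨i, h⟩ else 0)
    else 0
  coins := 0

/-- The output of a halted computation: the first `n` entries of array `2`. -/
def State.output (s : State) (n : ℕ) : Fin n → ℝ := fun u => s.real 2 u

/-- A finite sequence of coin flips as a tape. Every flip takes at least one step, so a computation of
at most `m` steps never reads beyond the first `m` entries. -/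
def tape {m : ℕ} (r : Fin m → Bool) : ℕ → Bool := fun i => if h : i < m then r ⟨i, h⟩ else false

/-- On the instance `(f, p, B)`, the program `A` halts within `m` steps whatever the outcomes `r` of
its (at most `m`) coin flips are, and its output is then `x r`. -/
def RunsWithin {n : ℕ} (A : Prog) (ε : ℝ) (f : Finset (Fin n) → ℝ) (p : Fin n → ℝ) (B : ℝ)
    (m : ℕ) (x : (Fin m → Bool) → Fin n → ℝ) : Prop :=
  ∀ r : Fin m → Bool, ∃ t ≤ m, ∃ s : State,
    Exec f (tape r) A (initState ε p B) t s ∧ s.output n = x r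

end OracleRAM

end

/-! ### The multilinear extension -/

/-! The algorithm is a measured continuous greedy process. It starts at `x = 0`, and each step adds
`δ (1 - 2 x u) z u` to `x u`, where `z` solves the fractional knapsack problem whose weights
estimate the expected gain of toggling `u` in a random set drawn from `x`. It stops when `(1 -
2δ)^k` is about to fall below `θ = 2ε`.

Value. The multilinear extension `F` of `f` is affine in each coordinate, and the expected gain of
toggling `u` is `(1 - 2 x u)` times the partial derivative (`multilinearExt_toggleGain`); a measured
step therefore collects exactly the toggle gains to first order (`multilinearExt_step_ge`). By
symmetry, removing `u` from `R` has the same effect as adding it to the complement, so submodularity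
bounds the total toggle gain over an optimal set `O` below by `f O - 2 f R`, for every `R`
(`le_sum_toggleGain`). Since `z` is at least as good as `charVec O` for the estimated weights
(`le_sum_fracKnapsack`), a step shrinks the gap `f O / 2 - F x` by the factor `1 - 2δ`, up to
errors. After `k` steps this leaves `(1 - (1 - 2δ)^k) / 2 * f O`, about `(1/2 - ε) * f O`
(`coinAvg_greedyPoint_ge`).

Feasibility. Each step multiplies `1 - 2 x u` by `1 - 2δ z u`, which is at least `(1 - 2δ)^(z u)` by
Bernoulli. With `b` the average of the directions, a point of the polytope, this gives `1 - 2 x u ≥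
θ^(b u)`. Convexity of `t ↦ θ^t` at the density `c` then bounds the cost of `x` by `β B`
(`mem_bicriteriaFeasible_of_rpow_le`).

Errors. Elements costing more than `B` are never touched, and on the remaining sets `f ≤ n * f O`,
so all errors are relative to `f O`. Step length `1 / (2 n^4)`, `n^6` samples per step and `n` coins
per coordinate make them vanish. `halts_greedyProg` shows that the program computes precisely this
process, and `exists_stepCount` bounds the number of steps. -/

theorem multilinearExt_update {n : ℕ} (g : Finset (Fin n) → ℝ) (y : Fin n → ℝ) (j : Fin n)
    (v : ℝ) :
    multilinearExt g (Function.update y j v) =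
      v * multilinearExt (fun S => g (insert j S)) y +
        (1 - v) * multilinearExt (fun S => g (S.erase j)) y := by
  have key : ∀ φ : Finset (Fin n) → ℝ, ∑ S, φ S =
      ∑ T ∈ (Finset.univ.erase j).powerset, (φ T + φ (insert j T)) := by
    intro φ
    rw [← Finset.powerset_univ, ← Finset.insert_erase (Finset.mem_univ j),
      Finset.sum_powerset_insert (Finset.notMem_erase j _), Finset.sum_add_distrib]
    simp
  unfold multilinearExt
  rw [key, key, key, Finset.mul_sum, Finset.mul_sum, ← Finset.sum_add_distrib]
  refine Finset.sum_congr rfl fun T hT => ?_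
  have hj : j ∉ T := fun h => by
    simpa using Finset.mem_powerset.1 hT h
  have hc : Tᶜ = insert j (insert j T)ᶜ := by
    ext u; by_cases h : u = j <;> simp [h, hj]
  have hj' : j ∉ (insert j T)ᶜ := by simp
  have e1 : ∏ u ∈ T, Function.update y j v u = ∏ u ∈ T, y u :=
    Finset.prod_congr rfl fun u hu => by
      rw [Function.update_of_ne]; rintro rfl; exact hj hu
  have e2 : ∏ u ∈ (insert j T)ᶜ, (1 - Function.update y j v u) =
      ∏ u ∈ (insert j T)ᶜ, (1 - y u) :=
    Finset.prod_congr rfl fun u hu => by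
      rw [Function.update_of_ne]; rintro rfl; exact hj' hu
  rw [hc, Finset.prod_insert hj', Finset.prod_insert hj', Finset.prod_insert hj,
    Finset.prod_insert hj, e1, e2]
  simp only [Function.update_self, Finset.insert_idem, Finset.erase_insert hj,
    Finset.erase_eq_of_notMem hj]
  ring

/-- Expanding `∏ u, (x u + (1 - x u)) = 1` shows that the weights of the sets sum to one; no range
condition on `x` is involved. -/
theorem multilinearExt_const {n : ℕ} (c : ℝ) (x : Fin n → ℝ) :
    multilinearExt (fun _ => c) x = c := by
  have := Finset.prod_add x (fun u => 1 - x u) Finset.univ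
  simp only [add_sub_cancel, Finset.prod_const_one, Finset.powerset_univ,
    ← Finset.compl_eq_univ_sdiff] at this
  unfold multilinearExt
  simp only [mul_assoc, ← Finset.mul_sum]
  rw [← this, mul_one]

theorem multilinearExt_sub {n : ℕ} (g h : Finset (Fin n) → ℝ) (x : Fin n → ℝ) :
    multilinearExt (fun S => g S - h S) x = multilinearExt g x - multilinearExt h x := by
  unfold multilinearExt
  rw [← Finset.sum_sub_distrib]
  exact Finset.sum_congr rfl fun S _ => by ring

theorem multilinearExt_const_mul {n : ℕ} (c : ℝ) (g : Finset (Fin n) → ℝ) (x : Fin n → ℝ) :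
    multilinearExt (fun S => c * g S) x = c * multilinearExt g x := by
  unfold multilinearExt
  rw [Finset.mul_sum]
  exact Finset.sum_congr rfl fun S _ => by ring

theorem multilinearExt_sum {n : ℕ} {ι : Type*} (s : Finset ι) (g : ι → Finset (Fin n) → ℝ)
    (x : Fin n → ℝ) :
    multilinearExt (fun S => ∑ i ∈ s, g i S) x = ∑ i ∈ s, multilinearExt (g i) x := by
  unfold multilinearExt
  rw [Finset.sum_comm]
  exact Finset.sum_congr rfl fun S _ => by rw [Finset.sum_mul, Finset.sum_mul]

theorem multilinearExt_mono {n : ℕ} {g h : Finset (Fin n) → ℝ} {x : Fin n → ℝ}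
    (hx : ∀ u, 0 ≤ x u ∧ x u ≤ 1) (hgh : ∀ S, g S ≤ h S) :
    multilinearExt g x ≤ multilinearExt h x := by
  refine Finset.sum_le_sum fun S _ => ?_
  rw [mul_assoc, mul_assoc]
  exact mul_le_mul_of_nonneg_right (hgh S) (mul_nonneg
    (Finset.prod_nonneg fun u _ => (hx u).1)
    (Finset.prod_nonneg fun u _ => sub_nonneg.2 (hx u).2))

theorem multilinearExt_nonneg {n : ℕ} {g : Finset (Fin n) → ℝ} {x : Fin n → ℝ}
    (hx : ∀ u, 0 ≤ x u ∧ x u ≤ 1) (hg : ∀ S, 0 ≤ g S) : 0 ≤ multilinearExt g x := by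
  simpa [multilinearExt_const] using multilinearExt_mono (g := fun _ => 0) hx hg

theorem abs_multilinearExt_le {n : ℕ} {g : Finset (Fin n) → ℝ} {x : Fin n → ℝ} {C : ℝ}
    (hx : ∀ u, 0 ≤ x u ∧ x u ≤ 1) (hg : ∀ S, |g S| ≤ C) : |multilinearExt g x| ≤ C := by
  rw [abs_le]
  constructor
  · simpa [multilinearExt_const] using
      multilinearExt_mono (g := fun _ => -C) hx fun S => (abs_le.1 (hg S)).1
  · simpa [multilinearExt_const] using
      multilinearExt_mono (h := fun _ => C) hx fun S => (abs_le.1 (hg S)).2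

/-- Values on sets outside the support of `x` do not matter. -/
theorem multilinearExt_congr {n : ℕ} {g h : Finset (Fin n) → ℝ} {x : Fin n → ℝ}
    (hgh : ∀ S : Finset (Fin n), (∀ u ∈ S, x u ≠ 0) → g S = h S) :
    multilinearExt g x = multilinearExt h x := by
  refine Finset.sum_congr rfl fun S _ => ?_
  by_cases hS : ∀ u ∈ S, x u ≠ 0
  · rw [hgh S hS]
  · push Not at hS
    obtain ⟨u, hu, h0⟩ := hS
    rw [Finset.prod_eq_zero hu h0]; simp

/-- The second factor is the partial derivative in direction `j`. It does not depend on `y j`,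
because neither set function looks at the membership of `j`. -/
theorem multilinearExt_update_sub {n : ℕ} (g : Finset (Fin n) → ℝ) (y : Fin n → ℝ) (j : Fin n)
    (v : ℝ) :
    multilinearExt g (Function.update y j v) - multilinearExt g y =
      (v - y j) * (multilinearExt (fun S => g (insert j S)) y -
        multilinearExt (fun S => g (S.erase j)) y) := by
  have h := multilinearExt_update g y j (y j)
  rw [Function.update_eq_self] at h
  rw [multilinearExt_update, h]
  ring

/-- The vector that agrees with `x'` on the first `j` coordinates and with `x` on the others. -/
def hybrid {n : ℕ} (x x' : Fin n → ℝ) (j : ℕ) : Fin n → ℝ :=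
  fun u => if (u : ℕ) < j then x' u else x u

theorem hybrid_succ {n : ℕ} (x x' : Fin n → ℝ) (j : Fin n) :
    hybrid x x' (j + 1) = Function.update (hybrid x x' j) j (x' j) := by
  ext u
  by_cases h : u = j
  · subst h; simp [hybrid]
  · have : (u : ℕ) ≠ j := fun e => h (Fin.ext e)
    rw [Function.update_of_ne h]
    simp only [hybrid]
    congr 1
    apply propext
    omega

theorem hybrid_self {n : ℕ} (x x' : Fin n → ℝ) (j : Fin n) : hybrid x x' j j = x j := by
  simp [hybrid]

theorem sum_hybrid_sub {n : ℕ} (H : (Fin n → ℝ) → ℝ) (x x' : Fin n → ℝ) :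
    ∑ j : Fin n, (H (hybrid x x' (j + 1)) - H (hybrid x x' j)) = H x' - H x := by
  rw [Fin.sum_univ_eq_sum_range (fun j => H (hybrid x x' (j + 1)) - H (hybrid x x' j)) n,
    Finset.sum_range_sub (fun j => H (hybrid x x' j))]
  congr 2
  ext u; simp [hybrid]

theorem hybrid_mem {n : ℕ} {x x' : Fin n → ℝ} (hx : ∀ u, 0 ≤ x u ∧ x u ≤ 1)
    (hx' : ∀ u, 0 ≤ x' u ∧ x' u ≤ 1) (j : ℕ) (u : Fin n) :
    0 ≤ hybrid x x' j u ∧ hybrid x x' j u ≤ 1 := by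
  unfold hybrid
  split_ifs
  exacts [hx' u, hx u]

/-- Passing from `x` to `x'` one coordinate at a time, each change is governed by a partial
derivative, a difference of two averages of size at most `C`. -/
theorem abs_multilinearExt_sub_le {n : ℕ} {g : Finset (Fin n) → ℝ} {x x' : Fin n → ℝ} {C : ℝ}
    (hx : ∀ u, 0 ≤ x u ∧ x u ≤ 1) (hx' : ∀ u, 0 ≤ x' u ∧ x' u ≤ 1) (hg : ∀ S, |g S| ≤ C) :
    |multilinearExt g x' - multilinearExt g x| ≤ 2 * C * ∑ u, |x' u - x u| := by
  rw [← sum_hybrid_sub, Finset.mul_sum]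
  refine (Finset.abs_sum_le_sum_abs _ _).trans (Finset.sum_le_sum fun j _ => ?_)
  rw [hybrid_succ, multilinearExt_update_sub, hybrid_self, abs_mul, mul_comm]
  refine mul_le_mul_of_nonneg_right ?_ (abs_nonneg _)
  have h1 := abs_multilinearExt_le (g := fun S => g (insert j S)) (hybrid_mem hx hx' j)
    (fun S => hg _)
  have h2 := abs_multilinearExt_le (g := fun S => g (S.erase j)) (hybrid_mem hx hx' j)
    (fun S => hg _)
  linarith [abs_sub (multilinearExt (fun S => g (insert j S)) (hybrid x x' j))
    (multilinearExt (fun S => g (S.erase j)) (hybrid x x' j))]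

/-- Change the membership of `u` in `S`. -/
def toggle {n : ℕ} (u : Fin n) (S : Finset (Fin n)) : Finset (Fin n) :=
  if u ∈ S then S.erase u else insert u S

/-- The gain of changing the membership of `u`. -/
def toggleGain {n : ℕ} (h : Finset (Fin n) → ℝ) (u : Fin n) (S : Finset (Fin n)) : ℝ :=
  h (toggle u S) - h S

/-- Toggling interchanges `insert u` and `erase u`, so the coefficients `x u` and `1 - x u` change
places; their difference is the factor `1 - 2 * x u`. -/
theorem multilinearExt_toggleGain {n : ℕ} (h : Finset (Fin n) → ℝ) (u : Fin n) (x : Fin n → ℝ) :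
    multilinearExt (toggleGain h u) x =
      (1 - 2 * x u) * (multilinearExt (fun S => h (insert u S)) x -
        multilinearExt (fun S => h (S.erase u)) x) := by
  have h1 := multilinearExt_update h x u (x u)
  have h2 := multilinearExt_update (fun S => h (toggle u S)) x u (x u)
  rw [Function.update_eq_self] at h1 h2
  have e1 : (fun S => h (toggle u (insert u S))) = fun S : Finset (Fin n) => h (S.erase u) := by
    ext S; simp [toggle, Finset.erase_insert_eq_erase]
  have e2 : (fun S => h (toggle u (S.erase u))) = fun S : Finset (Fin n) => h (insert u S) := by
    ext S
    simp only [toggle, Finset.notMem_erase, if_false]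
    congr 1
    ext v; by_cases hv : v = u <;> simp [hv]
  simp only [e1, e2] at h2
  unfold toggleGain
  rw [multilinearExt_sub, h1, h2]
  ring

/-- First-order lower bound for the multilinear extension along a measured step. -/
theorem multilinearExt_step_ge {n : ℕ} {h : Finset (Fin n) → ℝ} {x z : Fin n → ℝ} {C δ : ℝ}
    (hδ : 0 ≤ δ) (h0 : ∀ S, 0 ≤ h S) (hC : ∀ S, h S ≤ C)
    (hx : ∀ u, 0 ≤ x u ∧ x u ≤ 1) (hx' : ∀ u, 0 ≤ x u + δ * (1 - 2 * x u) * z u ∧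
      x u + δ * (1 - 2 * x u) * z u ≤ 1) (hz : ∀ u, 0 ≤ z u ∧ z u ≤ 1) :
    multilinearExt h x + δ * ∑ u, z u * multilinearExt (toggleGain h u) x - 2 * C * n ^ 2 * δ ^ 2 ≤
      multilinearExt h (fun u => x u + δ * (1 - 2 * x u) * z u) := by
  set x' : Fin n → ℝ := fun u => x u + δ * (1 - 2 * x u) * z u with hx'def
  have hC0 : 0 ≤ C := (h0 ∅).trans (hC ∅)
  have hg : ∀ u S, |toggleGain h u S| ≤ C := fun u S => by
    unfold toggleGain
    rw [abs_le]
    constructor <;> linarith [h0 S, hC S, h0 (toggle u S), hC (toggle u S)]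
  have hd : ∀ u, |x' u - x u| ≤ δ := fun u => by
    have : x' u - x u = δ * ((1 - 2 * x u) * z u) := by rw [hx'def]; ring
    rw [this, abs_mul, abs_of_nonneg hδ, abs_mul]
    refine mul_le_of_le_one_right hδ (mul_le_one₀ ?_ (abs_nonneg _) ?_)
    · rw [abs_le]; constructor <;> linarith [hx u]
    · rw [abs_le]; constructor <;> linarith [hz u]
  have hyb : ∀ j : Fin n, δ * (z j * multilinearExt (toggleGain h j) x) - 2 * C * n * δ ^ 2 ≤
      multilinearExt h (hybrid x x' (j + 1)) - multilinearExt h (hybrid x x' j) := fun j => by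
    -- No second-order term arises within one coordinate: `F` is affine there, and the hybrid point
    -- still has `x j` as coordinate `j`. The only loss is from evaluating the gain at the hybrid
    -- point instead of at `x`.
    have e : multilinearExt h (hybrid x x' (j + 1)) - multilinearExt h (hybrid x x' j) =
        δ * (z j * multilinearExt (toggleGain h j) (hybrid x x' j)) := by
      rw [hybrid_succ, multilinearExt_update_sub, multilinearExt_toggleGain, hybrid_self]
      simp only [hx'def]; ring
    have hl := abs_multilinearExt_sub_le (g := toggleGain h j) hx (hybrid_mem hx hx' j) (hg j)
    have hs : ∑ u, |hybrid x x' j u - x u| ≤ n * δ := by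
      refine (Finset.sum_le_card_nsmul _ _ δ fun u _ => ?_).trans (by simp)
      unfold hybrid
      split_ifs
      exacts [hd u, by simpa using hδ]
    have hl' : |multilinearExt (toggleGain h j) (hybrid x x' j) -
        multilinearExt (toggleGain h j) x| ≤ 2 * C * (n * δ) :=
      hl.trans (mul_le_mul_of_nonneg_left hs (by positivity))
    have h1 : z j * (multilinearExt (toggleGain h j) x -
        multilinearExt (toggleGain h j) (hybrid x x' j)) ≤ 2 * C * (n * δ) := by
      refine (le_abs_self _).trans ?_
      rw [abs_mul, abs_of_nonneg (hz j).1, abs_sub_comm]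
      exact (mul_le_of_le_one_left (abs_nonneg _) (hz j).2).trans hl'
    rw [e]
    nlinarith [mul_le_mul_of_nonneg_left h1 hδ]
  have hsum := Finset.sum_le_sum fun j (_ : j ∈ Finset.univ) => hyb j
  rw [sum_hybrid_sub, Finset.sum_sub_distrib, ← Finset.mul_sum, Finset.sum_const,
    Finset.card_univ, Fintype.card_fin, nsmul_eq_mul] at hsum
  nlinarith

/-! ### Symmetric submodular functions -/

theorem IsSubmodular.union_le_sum {n : ℕ} {f : Finset (Fin n) → ℝ} (hf : IsSubmodular f)
    (R A : Finset (Fin n)) (h : Disjoint A R) :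
    f (R ∪ A) - f R ≤ ∑ u ∈ A, (f (insert u R) - f R) := by
  induction A using Finset.induction_on with
  | empty => simp
  | insert a A ha ih =>
    rw [Finset.disjoint_insert_left] at h
    rw [Finset.sum_insert ha, Finset.union_insert]
    have := hf R (R ∪ A) Finset.subset_union_left a (by simp [h.1, ha])
    linarith [ih h.2]

/-- Adding the elements of `B` to `A` gains no more than adding them to `∅`; nonnegativity of `f ∅`
gives the rest. -/
theorem IsSubmodular.union_le {n : ℕ} {f : Finset (Fin n) → ℝ} (hf : IsSubmodular f)
    (h0 : ∀ S, 0 ≤ f S) (A B : Finset (Fin n)) (h : Disjoint B A) : f (A ∪ B) ≤ f A + f B := by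
  suffices f (A ∪ B) - f A ≤ f B - f ∅ by linarith [h0 ∅]
  induction B using Finset.induction_on with
  | empty => simp
  | insert b B hb ih =>
    rw [Finset.disjoint_insert_left] at h
    rw [Finset.union_insert]
    have := hf B (A ∪ B) Finset.subset_union_right b (by simp [h.1, hb])
    linarith [ih h.2]

/-- Additions to `R` gain at least `f (R ∪ O) - f R`. Removals from `R` are, by symmetry, additions
to `Rᶜ` and gain at least `f (R \ O) - f R`. Finally `f (R ∪ O) + f (R \ O) ≥ f O`, because `(R ∪
O)ᶜ` and `R \ O` are disjoint with union `Oᶜ`. -/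
theorem le_sum_toggleGain {n : ℕ} {f : Finset (Fin n) → ℝ} (hf : IsSubmodular f)
    (h0 : ∀ S, 0 ≤ f S) (hs : IsSymmetricSetFun f) (R O : Finset (Fin n)) :
    f O - 2 * f R ≤ ∑ u ∈ O, toggleGain f u R := by
  have h1 := hf.union_le_sum R (O \ R) Finset.sdiff_disjoint
  have h2 := hf.union_le_sum Rᶜ (O ∩ R) (by
    rw [Finset.disjoint_left]; intro u; simp)
  have h3 := hf.union_le h0 (R ∪ O)ᶜ (R \ O) (by
    rw [Finset.disjoint_left]; intro u; simp; tauto)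
  have e1 : (R ∪ O)ᶜ ∪ R \ O = Oᶜ := by ext u; simp; tauto
  have e2 : Rᶜ ∪ O ∩ R = (R \ O)ᶜ := by ext u; simp; tauto
  have e3 : R ∪ O \ R = R ∪ O := by simp
  rw [e1, hs, hs] at h3
  rw [e2, hs, hs] at h2
  rw [e3] at h1
  have h4 : ∑ u ∈ O \ R, (f (insert u R) - f R) = ∑ u ∈ O \ R, toggleGain f u R :=
    Finset.sum_congr rfl fun u hu => by
      simp [toggleGain, toggle, (Finset.mem_sdiff.1 hu).2]
  have h5 : ∑ u ∈ O ∩ R, (f (insert u Rᶜ) - f R) = ∑ u ∈ O ∩ R, toggleGain f u R :=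
    Finset.sum_congr rfl fun u hu => by
      have : insert u Rᶜ = (R.erase u)ᶜ := by ext v; simp
      rw [this, hs]
      simp [toggleGain, toggle, (Finset.mem_inter.1 hu).2]
  rw [h4] at h1
  rw [h5] at h2
  have h6 := Finset.sum_inter_add_sum_sdiff O R (fun u => toggleGain f u R)
  linarith

/-- Diminishing returns from `∅` give `f A ≤ f ∅ + |A| (V - f ∅)`; for nonempty `A` the terms in `f
∅` contribute at most zero. Applied to a restriction of `f`, this is the a priori bound on all
values the process meets. -/
theorem IsSubmodular.le_card_mul {n : ℕ} {f : Finset (Fin n) → ℝ} (hf : IsSubmodular f)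
    (h0 : ∀ S, 0 ≤ f S) {V : ℝ} (A : Finset (Fin n)) (hn : 1 ≤ n) (he : f ∅ ≤ V)
    (h1 : ∀ u ∈ A, f {u} ≤ V) : f A ≤ n * V := by
  have hV : 0 ≤ V := (h0 ∅).trans he
  have hn' : (1 : ℝ) ≤ n := by exact_mod_cast hn
  rcases A.eq_empty_or_nonempty with rfl | hA
  · nlinarith
  have h := hf.union_le_sum ∅ A (by simp)
  have h2 : ∑ u ∈ A, (f (insert u ∅) - f ∅) ≤ A.card * (V - f ∅) := by
    rw [← nsmul_eq_mul]
    exact Finset.sum_le_card_nsmul _ _ _ fun u hu => by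
      have := h1 u hu
      simp only [insert_empty_eq]; linarith
  rw [Finset.empty_union] at h
  have h3 : (1 : ℝ) ≤ A.card := by exact_mod_cast hA.card_pos
  have h4 : (A.card : ℝ) ≤ n := by
    exact_mod_cast (Finset.card_le_univ A).trans (by simp)
  nlinarith [h0 ∅]

/-! ### The fractional knapsack problem -/

section Knapsack

variable {n : ℕ}

/-- The elements that a fractional solution may use: positive weight, cost within the budget. -/
def Eligible (p : Fin n → ℝ) (B : ℝ) (w : Fin n → ℝ) (u : Fin n) : Prop := ¬ w u ≤ 0 ∧ p u ≤ B

open Classical in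
/-- The total cost of the eligible elements whose density is larger than that of `u`. -/
noncomputable def lowSum (p : Fin n → ℝ) (B : ℝ) (w : Fin n → ℝ) (u : Fin n) : ℝ :=
  ∑ v, if Eligible p B w v ∧ ¬ w v * p u ≤ w u * p v then p v else 0

open Classical in
/-- The total cost of the eligible elements whose density is at least that of `u`. -/
noncomputable def highSum (p : Fin n → ℝ) (B : ℝ) (w : Fin n → ℝ) (u : Fin n) : ℝ :=
  ∑ v, if Eligible p B w v ∧ w u * p v ≤ w v * p u then p v else 0

open Classical in
/-- An optimal solution of the fractional knapsack problem with weights `w`: elements are taken by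
decreasing density, and all elements of the critical density are taken to the same extent. -/
noncomputable def fracKnapsack (p : Fin n → ℝ) (B : ℝ) (w : Fin n → ℝ) (u : Fin n) : ℝ :=
  if Eligible p B w u then
    if highSum p B w u ≤ B then 1
    else if lowSum p B w u ≤ B then
      (B - lowSum p B w u) / (highSum p B w u - lowSum p B w u)
    else 0
  else 0

variable {p : Fin n → ℝ} {B : ℝ} {w : Fin n → ℝ}

theorem fracKnapsack_mem_Icc (u : Fin n) :
    0 ≤ fracKnapsack p B w u ∧ fracKnapsack p B w u ≤ 1 := by
  unfold fracKnapsack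
  split_ifs with h1 h2 h3
  · simp
  · push Not at h2
    have : 0 < highSum p B w u - lowSum p B w u := by linarith
    exact ⟨div_nonneg (by linarith) this.le, (div_le_one this).2 (by linarith)⟩
  · simp
  · simp

theorem fracKnapsack_eq_zero {u : Fin n} (h : ¬ p u ≤ B) : fracKnapsack p B w u = 0 := by
  unfold fracKnapsack
  rw [if_neg fun e => h e.2]

/-- Every sum and test involves eligible elements only, so weights of elements that do not fit alone
are irrelevant. This lets `f` be replaced by a bounded function in the analysis. -/
theorem fracKnapsack_congr {w' : Fin n → ℝ} (h : ∀ u, p u ≤ B → w u = w' u) :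
    fracKnapsack p B w = fracKnapsack p B w' := by
  have hE : Eligible p B w = Eligible p B w' := funext fun v => propext <| by
    unfold Eligible
    constructor
    · rintro ⟨a, b⟩; exact ⟨by rwa [← h v b], b⟩
    · rintro ⟨a, b⟩; exact ⟨by rwa [h v b], b⟩
  have hl : ∀ u, p u ≤ B → lowSum p B w u = lowSum p B w' u := fun u hu => by
    unfold lowSum
    refine Finset.sum_congr rfl fun v _ => ?_
    by_cases hv : p v ≤ B
    · rw [h u hu, h v hv, hE]
    · rw [if_neg fun e => hv e.1.2, if_neg fun e => hv e.1.2]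
  have hh : ∀ u, p u ≤ B → highSum p B w u = highSum p B w' u := fun u hu => by
    unfold highSum
    refine Finset.sum_congr rfl fun v _ => ?_
    by_cases hv : p v ≤ B
    · rw [h u hu, h v hv, hE]
    · rw [if_neg fun e => hv e.1.2, if_neg fun e => hv e.1.2]
  ext u
  by_cases hu : p u ≤ B
  · unfold fracKnapsack
    rw [hl u hu, hh u hu, hE]
  · rw [fracKnapsack_eq_zero hu, fracKnapsack_eq_zero hu]

open Classical in
/-- Either all eligible elements fit, or there is a critical density. -/
theorem fracKnapsack_cases (hp : ∀ u, 0 ≤ p u) (hB : 0 ≤ B) :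
    ((∀ u, Eligible p B w u → fracKnapsack p B w u = 1) ∧ ∑ u, p u * fracKnapsack p B w u ≤ B) ∨
    ∃ l : ℝ, 0 ≤ l ∧ ∑ u, p u * fracKnapsack p B w u = B ∧
      ∀ u, Eligible p B w u → (l * p u < w u → fracKnapsack p B w u = 1) ∧
        (w u < l * p u → fracKnapsack p B w u = 0) := by
  by_cases hbad : ∀ u, Eligible p B w u → highSum p B w u ≤ B
  · left
    have h1 : ∀ u, Eligible p B w u → fracKnapsack p B w u = 1 := fun u hu => by
      unfold fracKnapsack; rw [if_pos hu, if_pos (hbad u hu)]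
    refine ⟨h1, ?_⟩
    have h2 : ∀ u, p u * fracKnapsack p B w u = if Eligible p B w u then p u else 0 := fun u => by
      split_ifs with hu
      · rw [h1 u hu, mul_one]
      · unfold fracKnapsack; rw [if_neg hu, mul_zero]
    simp only [h2]
    rcases (Finset.univ.filter fun u => Eligible p B w u ∧ 0 < p u).eq_empty_or_nonempty with h | h
    · refine (Finset.sum_nonpos fun u _ => ?_).trans hB
      split_ifs with hu
      · by_contra hpos
        have : u ∈ (Finset.univ.filter fun u => Eligible p B w u ∧ 0 < p u) := by
          simp [hu]; linarith
        simp [h] at this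
      · exact le_rfl
    -- Every eligible element of positive cost is at least as dense as the least dense one, so the
    -- high sum of `m` is the whole cost.
    · obtain ⟨m, hm, hmin⟩ := Finset.exists_min_image _ (fun u => w u / p u) h
      simp only [Finset.mem_filter, Finset.mem_univ, true_and] at hm hmin
      refine le_trans (Finset.sum_le_sum fun v _ => ?_) (hbad m hm.1)
      by_cases hv : Eligible p B w v
      · rcases (hp v).eq_or_lt with h0 | h0
        · simp [← h0]
        · have := hmin v ⟨hv, h0⟩
          rw [div_le_div_iff₀ hm.2 h0] at this
          rw [if_pos hv, if_pos ⟨hv, this⟩]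
      · rw [if_neg hv, if_neg fun e => hv e.1]
  · right
    push Not at hbad
    -- An eligible element of cost zero is infinitely dense: only elements of cost zero enter its
    -- high sum, which therefore fits.
    have hppos : ∀ u, Eligible p B w u → B < highSum p B w u → 0 < p u := fun u hu h => by
      rcases (hp u).eq_or_lt with h0 | h0
      · exfalso
        have : highSum p B w u ≤ 0 := Finset.sum_nonpos fun v _ => by
          split_ifs with hv
          · rw [← h0, mul_zero] at hv
            have := hu.1
            push Not at this
            by_contra hc
            push Not at hc
            linarith [mul_pos this hc, hv.2]
          · exact le_rfl
        linarith
      · exact h0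
    -- The densest element that overflows the budget determines the critical density `l`.
    obtain ⟨k, hk, hmax⟩ := Finset.exists_max_image
      (Finset.univ.filter fun u => Eligible p B w u ∧ B < highSum p B w u) (fun u => w u / p u)
      (by obtain ⟨u, hu⟩ := hbad; exact ⟨u, by simpa using hu⟩)
    simp only [Finset.mem_filter, Finset.mem_univ, true_and] at hk hmax
    have hpk := hppos k hk.1 hk.2
    have hwk : 0 < w k := not_le.1 hk.1.1
    set l := w k / p k with hl
    have hl0 : 0 < l := div_pos hwk hpk
    have hwl : w k = l * p k := by rw [hl]; field_simp
    have klow : lowSum p B w k =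
        ∑ v, if Eligible p B w v ∧ l * p v < w v then p v else 0 := by
      refine Finset.sum_congr rfl fun v _ => ?_
      congr 2
      rw [hwl, not_le, mul_right_comm, mul_lt_mul_iff_left₀ hpk]
    have khigh : highSum p B w k =
        ∑ v, if Eligible p B w v ∧ l * p v ≤ w v then p v else 0 := by
      refine Finset.sum_congr rfl fun v _ => ?_
      congr 2
      rw [hwl, mul_right_comm, mul_le_mul_iff_left₀ hpk]
    have hlow : lowSum p B w k ≤ B := by
      rw [klow]
      rcases (Finset.univ.filter fun u => Eligible p B w u ∧ l * p u < w u ∧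
        0 < p u).eq_empty_or_nonempty with h | h
      · refine (Finset.sum_nonpos fun u _ => ?_).trans hB
        split_ifs with hu
        · by_contra hpos
          have : u ∈ (Finset.univ.filter fun u => Eligible p B w u ∧ l * p u < w u ∧
              0 < p u) := by
            simp [hu]; linarith
          simp [h] at this
        · exact le_rfl
      -- Among the elements denser than `l`, the least dense one has a high sum that dominates the
      -- low sum of `k`, and it fits by the maximality of `k`.
      · obtain ⟨m, hm, hmin⟩ := Finset.exists_min_image _ (fun u => w u / p u) h
        simp only [Finset.mem_filter, Finset.mem_univ, true_and] at hm hmin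
        have hmb : highSum p B w m ≤ B := by
          by_contra hc
          have := hmax m ⟨hm.1, not_le.1 hc⟩
          rw [div_le_iff₀ hm.2.2] at this
          linarith [hm.2.1]
        refine le_trans (Finset.sum_le_sum fun v _ => ?_) hmb
        by_cases hv : Eligible p B w v ∧ l * p v < w v
        · rcases (hp v).eq_or_lt with h0 | h0
          · simp [← h0]
          · have := hmin v ⟨hv.1, hv.2, h0⟩
            rw [div_le_div_iff₀ hm.2.2 h0] at this
            rw [if_pos hv, if_pos ⟨hv.1, this⟩]
        · rw [if_neg hv]
          split_ifs
          exacts [hp v, le_rfl]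
    set t := (B - lowSum p B w k) / (highSum p B w k - lowSum p B w k) with ht
    have z1 : ∀ u, Eligible p B w u → l * p u < w u → fracKnapsack p B w u = 1 := by
      intro u hu hlu
      have : highSum p B w u ≤ B := by
        by_contra hc
        have := hmax u ⟨hu, not_le.1 hc⟩
        rw [div_le_iff₀ (hppos u hu (not_le.1 hc))] at this
        linarith
      unfold fracKnapsack
      rw [if_pos hu, if_pos this]
    have zt : ∀ u, Eligible p B w u → l * p u = w u → fracKnapsack p B w u = t := by
      intro u hu hlu
      have hwu : 0 < w u := not_le.1 hu.1
      have hpu : 0 < p u := pos_of_mul_pos_right (hlu ▸ hwu) hl0.le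
      have e1 : lowSum p B w u = lowSum p B w k := by
        rw [klow]
        refine Finset.sum_congr rfl fun v _ => ?_
        congr 2
        rw [← hlu, not_le, mul_right_comm, mul_lt_mul_iff_left₀ hpu]
      have e2 : highSum p B w u = highSum p B w k := by
        rw [khigh]
        refine Finset.sum_congr rfl fun v _ => ?_
        congr 2
        rw [← hlu, mul_right_comm, mul_le_mul_iff_left₀ hpu]
      unfold fracKnapsack
      rw [if_pos hu, e1, e2, if_neg (not_le.2 hk.2), if_pos hlow]
    have z0 : ∀ u, Eligible p B w u → w u < l * p u → fracKnapsack p B w u = 0 := by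
      intro u hu hlu
      have hwu : 0 < w u := not_le.1 hu.1
      have hpu : 0 < p u := pos_of_mul_pos_right (hwu.trans hlu) hl0.le
      -- Everything at least as dense as `k` is strictly denser than `u` (or free), so already the
      -- low sum of `u` exceeds the budget.
      have h1 : highSum p B w k ≤ lowSum p B w u := by
        rw [khigh]
        refine Finset.sum_le_sum fun v _ => ?_
        by_cases hv : Eligible p B w v ∧ l * p v ≤ w v
        · rw [if_pos hv]
          rcases (hp v).eq_or_lt with h0 | h0
          · simp [← h0]
          · have : w u * p v < w v * p u := by
              nlinarith [mul_le_mul_of_nonneg_right hv.2 hpu.le, mul_lt_mul_of_pos_right hlu h0]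
            rw [if_pos ⟨hv.1, not_le.2 this⟩]
        · rw [if_neg hv]
          split_ifs
          exacts [hp v, le_rfl]
      have h2 : lowSum p B w u ≤ highSum p B w u := Finset.sum_le_sum fun v _ => by
        by_cases hv : Eligible p B w v ∧ ¬ w v * p u ≤ w u * p v
        · rw [if_pos hv, if_pos ⟨hv.1, (not_le.1 hv.2).le⟩]
        · rw [if_neg hv]
          split_ifs
          exacts [hp v, le_rfl]
      unfold fracKnapsack
      rw [if_pos hu, if_neg (by linarith [hk.2]), if_neg (by linarith [hk.2])]
    refine ⟨l, hl0.le, ?_, fun u hu => ⟨z1 u hu, z0 u hu⟩⟩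
    have hsum : ∑ u, p u * fracKnapsack p B w u =
        lowSum p B w k + t * (highSum p B w k - lowSum p B w k) := by
      rw [klow, khigh, ← Finset.sum_sub_distrib, Finset.mul_sum, ← Finset.sum_add_distrib]
      refine Finset.sum_congr rfl fun u _ => ?_
      by_cases hu : Eligible p B w u
      · rcases lt_trichotomy (l * p u) (w u) with h | h | h
        · rw [z1 u hu h, if_pos ⟨hu, h⟩, if_pos ⟨hu, h.le⟩]; ring
        · rw [zt u hu h, if_neg fun e => e.2.ne h, if_pos ⟨hu, h.le⟩]; ring
        · rw [z0 u hu h, if_neg fun e => (h.trans e.2).false,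
            if_neg fun e => (h.trans_le e.2).false]; ring
      · rw [if_neg fun e => hu e.1, if_neg fun e => hu e.1]
        unfold fracKnapsack
        rw [if_neg hu]; ring
    have hd : highSum p B w k - lowSum p B w k ≠ 0 := by
      have := hk.2; intro h; linarith
    rw [hsum, ht, div_mul_cancel₀ _ hd]
    ring

theorem sum_fracKnapsack_le (hp : ∀ u, 0 ≤ p u) (hB : 0 ≤ B) :
    ∑ u, p u * fracKnapsack p B w u ≤ B := by
  rcases fracKnapsack_cases (w := w) hp hB with h | ⟨l, _, h, _⟩
  exacts [h.2, h.le]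

/-- Linear programming duality with the critical density `l` as multiplier: the sign of `w u - l * p
u` decides whether the solution is `1` or `0` at an eligible element, so `(w u - l * p u) * (z u - y
u) ≥ 0` termwise; sum and use that the solution spends the whole budget. -/
theorem le_sum_fracKnapsack (hp : ∀ u, 0 ≤ p u) (hB : 0 ≤ B) {y : Fin n → ℝ}
    (hy : ∀ u, 0 ≤ y u ∧ y u ≤ 1) (hyB : ∑ u, p u * y u ≤ B) (hy0 : ∀ u, ¬ p u ≤ B → y u = 0) :
    ∑ u, w u * y u ≤ ∑ u, w u * fracKnapsack p B w u := by
  have hne : ∀ u, ¬ Eligible p B w u → w u * y u ≤ 0 ∧ fracKnapsack p B w u = 0 := by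
    intro u hu
    refine ⟨?_, by unfold fracKnapsack; rw [if_neg hu]⟩
    by_cases hpu : p u ≤ B
    · have : w u ≤ 0 := by
        by_contra hc; exact hu ⟨hc, hpu⟩
      exact mul_nonpos_of_nonpos_of_nonneg this (hy u).1
    · rw [hy0 u hpu, mul_zero]
  rcases fracKnapsack_cases (w := w) hp hB with ⟨h, _⟩ | ⟨l, hl, hs, h⟩
  · refine Finset.sum_le_sum fun u _ => ?_
    by_cases hu : Eligible p B w u
    · rw [h u hu]
      exact mul_le_mul_of_nonneg_left (hy u).2 (not_le.1 hu.1).le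
    · rw [(hne u hu).2, mul_zero]; exact (hne u hu).1
  · have key : ∀ u, l * (p u * fracKnapsack p B w u) - l * (p u * y u) ≤
        w u * fracKnapsack p B w u - w u * y u := by
      intro u
      suffices 0 ≤ (w u - l * p u) * (fracKnapsack p B w u - y u) by linarith
      by_cases hu : Eligible p B w u
      · rcases lt_trichotomy (l * p u) (w u) with h' | h' | h'
        · rw [(h u hu).1 h']
          exact mul_nonneg (by linarith) (by linarith [hy u])
        · rw [h']; simp
        · rw [(h u hu).2 h']
          exact mul_nonneg_of_nonpos_of_nonpos (by linarith) (by linarith [hy u])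
      · rw [(hne u hu).2]
        nlinarith [(hne u hu).1, mul_nonneg hl (mul_nonneg (hp u) (hy u).1)]
    have := Finset.sum_le_sum fun u (_ : u ∈ Finset.univ) => key u
    rw [Finset.sum_sub_distrib, Finset.sum_sub_distrib, ← Finset.mul_sum, ← Finset.mul_sum, hs]
      at this
    nlinarith [mul_le_mul_of_nonneg_left hyB hl]

end Knapsack

/-! ### Bicriteria feasibility -/

/-- Division by zero yields zero, so a positive density already excludes a vanishing total cost. -/
theorem budget_eq_density_mul {n : ℕ} {p : Fin n → ℝ} {B : ℝ} (hp : ∀ u, 0 ≤ p u)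
    (hc : 0 < density p B) : 0 < ∑ u, p u ∧ 0 < B ∧ B = density p B * ∑ u, p u := by
  have e : ∑ u, |p u| = ∑ u, p u := Finset.sum_congr rfl fun u _ => abs_of_nonneg (hp u)
  have h0 : 0 ≤ ∑ u, p u := Finset.sum_nonneg fun u _ => hp u
  unfold density at hc ⊢
  rw [e] at hc ⊢
  have hP : 0 < ∑ u, p u := by
    rcases h0.eq_or_lt with h | h
    · rw [← h, div_zero] at hc; exact absurd hc (lt_irrefl _)
    · exact h
  exact ⟨hP, (div_pos_iff_of_pos_right hP).1 hc, by field_simp⟩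

/-- It suffices that `x / β` lies in the polytope. The bound `x u ≤ β` is Bernoulli's inequality for
`θ ^ c`; the cost bound replaces `θ ^ t` by its tangent at `t = c`, where the deviation of `b` from
`c` has nonpositive total cost because `B` is `c` times the total cost. -/
theorem mem_bicriteriaFeasible_of_rpow_le {n : ℕ} {p : Fin n → ℝ} {B θ : ℝ} {x b : Fin n → ℝ}
    (hp : ∀ u, 0 ≤ p u) (hc : 0 < density p B) (hc1 : density p B < 1) (hθ : 0 < θ) (hθ1 : θ ≤ 1)
    (hb : b ∈ knapsackPolytope p B) (hx0 : ∀ u, 0 ≤ x u) (hx : ∀ u, θ ^ b u ≤ 1 - 2 * x u) :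
    x ∈ bicriteriaFeasible (knapsackPolytope p B)
      ((1 - θ ^ density p B) / (2 * density p B)) := by
  obtain ⟨hP, hB, hBc⟩ := budget_eq_density_mul hp hc
  set c := density p B with hcdef
  set β := (1 - θ ^ c) / (2 * c) with hβ
  have hlog : Real.log θ ≤ 0 := Real.log_nonpos hθ.le hθ1
  have hθc : 0 < θ ^ c := Real.rpow_pos_of_pos hθ c
  have hθc1 : θ ^ c ≤ 1 := Real.rpow_le_one hθ.le hθ1 hc.le
  have hβ0 : 0 ≤ β := div_nonneg (by linarith) (by linarith)
  have hx1 : ∀ u, x u ≤ (1 - θ) / 2 := fun u => by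
    have : θ ^ (1 : ℝ) ≤ θ ^ b u := Real.rpow_le_rpow_of_exponent_ge hθ hθ1 (hb.1 u).2
    rw [Real.rpow_one] at this
    linarith [hx u]
  have hxβ : ∀ u, x u ≤ β := fun u => by
    have hber : θ ^ c ≤ 1 - c * (1 - θ) := by
      have := rpow_one_add_le_one_add_mul_self (s := θ - 1) (by linarith) hc.le hc1.le
      rw [add_sub_cancel] at this
      linarith
    refine (hx1 u).trans ?_
    rw [hβ, le_div_iff₀ (by linarith)]
    linarith
  have hsum : ∑ u, p u * x u ≤ β * B := by
    -- The tangent bound `θ ^ c * (1 + log θ * (b u - c)) ≤ θ ^ b u`, multiplied by the cost.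
    have ht : ∀ u, p u * x u ≤ (p u - θ ^ c * p u - θ ^ c * Real.log θ * (p u * b u) +
        θ ^ c * Real.log θ * c * p u) / 2 := fun u => by
      have h1 : θ ^ c * (1 + Real.log θ * (b u - c)) ≤ θ ^ b u := by
        have h2 : θ ^ b u = θ ^ c * Real.exp (Real.log θ * (b u - c)) := by
          rw [← Real.rpow_def_of_pos hθ, ← Real.rpow_add hθ]; congr 1; ring
        rw [h2]
        exact mul_le_mul_of_nonneg_left (by linarith [Real.add_one_le_exp (Real.log θ * (b u - c))])
          hθc.le
      have := mul_le_mul_of_nonneg_left (h1.trans (hx u)) (hp u)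
      linarith
    refine (Finset.sum_le_sum fun u _ => ht u).trans ?_
    rw [← Finset.sum_div, Finset.sum_add_distrib, Finset.sum_sub_distrib, Finset.sum_sub_distrib,
      ← Finset.mul_sum, ← Finset.mul_sum, ← Finset.mul_sum]
    -- The slope is nonpositive, which reverses the budget inequality into the direction needed.
    have h3 : θ ^ c * Real.log θ * B ≤ θ ^ c * Real.log θ * ∑ u, p u * b u :=
      mul_le_mul_of_nonpos_left hb.2 (mul_nonpos_of_nonneg_of_nonpos hθc.le hlog)
    have h4 : β * B = (1 - θ ^ c) * (∑ u, p u) / 2 := by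
      rw [hβ, div_mul_eq_mul_div, div_eq_div_iff (by positivity) (by norm_num)]
      linear_combination 2 * (1 - θ ^ c) * hBc
    rw [h4]
    have h5 : θ ^ c * Real.log θ * c * ∑ u, p u = θ ^ c * Real.log θ * B := by
      linear_combination -(θ ^ c * Real.log θ) * hBc
    linarith
  have hz : (0 : Fin n → ℝ) ∈ knapsackPolytope p B := ⟨fun u => by simp, by simpa using hB.le⟩
  refine ⟨fun u => ⟨hx0 u, by linarith [hx1 u]⟩, 0, hz, ?_⟩
  -- If `β = 0`, scaling by `β⁻¹` is impossible, but then `x` itself vanishes.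
  rcases hβ0.eq_or_lt with h0 | h0
  · refine ⟨0, hz, fun u => hx0 u, fun u => ?_⟩
    have := hxβ u
    rw [← h0] at this
    simpa using this
  · refine ⟨β⁻¹ • x, ⟨fun u => ?_, ?_⟩, fun u => hx0 u, fun u => ?_⟩
    · simp only [Pi.smul_apply, smul_eq_mul]
      refine ⟨mul_nonneg (inv_nonneg.2 h0.le) (hx0 u), ?_⟩
      rw [inv_mul_le_iff₀ h0, mul_one]; exact hxβ u
    · simp only [Pi.smul_apply, smul_eq_mul]
      have : ∑ u, p u * (β⁻¹ * x u) = β⁻¹ * ∑ u, p u * x u := by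
        rw [Finset.mul_sum]; exact Finset.sum_congr rfl fun u _ => by ring
      rw [this, inv_mul_le_iff₀ h0]; exact hsum
    · simp only [Pi.smul_apply, smul_eq_mul]
      rw [mul_inv_cancel_left₀ h0.ne']

/-! ### Averages over finitely many fair coins -/

open OracleRAM (tape)

/-- The average of `G` over the outcomes of the first `m` coins. -/
noncomputable def coinAvg (m : ℕ) (G : (ℕ → Bool) → ℝ) : ℝ := 𝔼 r : Fin m → Bool, G (tape r)

/-- The first `a` coins of `ω` followed by the coins of `ω'`. -/
def joinTape (a : ℕ) (ω ω' : ℕ → Bool) : ℕ → Bool := fun i => if i < a then ω i else ω' (i - a)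

/-- The coins of `ω` after the first `c`. -/
def shiftTape (c : ℕ) (ω : ℕ → Bool) : ℕ → Bool := fun i => ω (c + i)

theorem shiftTape_joinTape (a : ℕ) (ω ω' : ℕ → Bool) : shiftTape a (joinTape a ω ω') = ω' := by
  ext i; simp [shiftTape, joinTape]

theorem shiftTape_shiftTape (a b : ℕ) (ω : ℕ → Bool) :
    shiftTape a (shiftTape b ω) = shiftTape (b + a) ω := by
  ext i; simp [shiftTape, add_assoc]

/-- `Y` reads only the first `d` coins. -/
def ReadsFirst {α : Type*} (d : ℕ) (Y : (ℕ → Bool) → α) : Prop :=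
  ∀ ω ω' : ℕ → Bool, (∀ i < d, ω i = ω' i) → Y ω = Y ω'

theorem ReadsFirst.shift {α : Type*} {d e c : ℕ} {Y : (ℕ → Bool) → α} (h : ReadsFirst d Y)
    (he : c + d ≤ e) : ReadsFirst e fun ω => Y (shiftTape c ω) :=
  fun ω ω' hω => h _ _ fun i hi => hω (c + i) (by omega)

theorem ReadsFirst.join {α : Type*} {d : ℕ} {Y : (ℕ → Bool) → α} (h : ReadsFirst d Y)
    (ω ω' : ℕ → Bool) : Y (joinTape d ω ω') = Y ω :=
  h _ _ fun i hi => by simp [joinTape, hi]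

theorem ReadsFirst.comp {α β : Type*} {d : ℕ} {Y : (ℕ → Bool) → α} (h : ReadsFirst d Y)
    (g : α → β) : ReadsFirst d fun ω => g (Y ω) :=
  fun ω ω' hω => congrArg g (h ω ω' hω)

/-- Fubini for fair coins: a tape of `a + b` coins is a pair of independent tapes. Together with
`ReadsFirst` and `shiftTape` it takes the place of independence. -/
theorem coinAvg_append (a b : ℕ) (G : (ℕ → Bool) → ℝ) :
    coinAvg (a + b) G = coinAvg a fun ω => coinAvg b fun ω' => G (joinTape a ω ω') := by
  unfold coinAvg
  rw [← Finset.expect_product' Finset.univ Finset.univ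
    (fun (r : Fin a → Bool) (r' : Fin b → Bool) => G (joinTape a (tape r) (tape r'))),
    Finset.univ_product_univ]
  refine (Fintype.expect_equiv (Fin.appendEquiv a b) _ _ fun r => ?_).symm
  congr 1
  ext i
  simp only [joinTape, tape, Fin.appendEquiv, Equiv.coe_fn_mk]
  by_cases h : i < a
  · have : (⟨i, by omega⟩ : Fin (a + b)) = Fin.castAdd b ⟨i, h⟩ := rfl
    rw [if_pos h, dif_pos h, dif_pos (by omega), this, Fin.append_left]
  · rw [if_neg h]
    by_cases h' : i < a + b
    · have : (⟨i, h'⟩ : Fin (a + b)) = Fin.natAdd a ⟨i - a, by omega⟩ :=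
        Fin.ext (by simp; omega)
      rw [dif_pos h', dif_pos (by omega), this, Fin.append_right]
    · rw [dif_neg h', dif_neg (by omega)]

theorem coinAvg_const (m : ℕ) (c : ℝ) : coinAvg m (fun _ => c) = c :=
  Fintype.expect_const c

theorem coinAvg_one (G : (ℕ → Bool) → ℝ) :
    coinAvg 1 G = (G (tape fun _ : Fin 1 => true) + G (tape fun _ : Fin 1 => false)) / 2 := by
  unfold coinAvg
  rw [Fintype.expect_equiv (Equiv.funUnique (Fin 1) Bool) _
    (fun b => G (tape fun _ : Fin 1 => b)) (fun r => by
      congr 2; ext i; rw [Subsingleton.elim i default]; rfl),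
    Fintype.expect_eq_sum_div_card]
  simp

theorem coinAvg_add (m : ℕ) (G H : (ℕ → Bool) → ℝ) :
    coinAvg m (fun ω => G ω + H ω) = coinAvg m G + coinAvg m H :=
  Finset.expect_add_distrib _ _ _

theorem coinAvg_const_mul (m : ℕ) (c : ℝ) (G : (ℕ → Bool) → ℝ) :
    coinAvg m (fun ω => c * G ω) = c * coinAvg m G :=
  (Finset.mul_expect _ _ _).symm

theorem coinAvg_sub (m : ℕ) (G H : (ℕ → Bool) → ℝ) :
    coinAvg m (fun ω => G ω - H ω) = coinAvg m G - coinAvg m H :=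
  Finset.expect_sub_distrib _ _ _

theorem coinAvg_sum {ι : Type*} (s : Finset ι) (m : ℕ) (G : ι → (ℕ → Bool) → ℝ) :
    coinAvg m (fun ω => ∑ i ∈ s, G i ω) = ∑ i ∈ s, coinAvg m (G i) :=
  Finset.expect_sum_comm _ _ _

theorem coinAvg_mono {m : ℕ} {G H : (ℕ → Bool) → ℝ} (h : ∀ ω, G ω ≤ H ω) :
    coinAvg m G ≤ coinAvg m H :=
  Finset.expect_le_expect fun _ _ => h _

/-- Coins that are never read do not influence an average; this matches the coins actually used with
the longer tape allowed by the time bound. -/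
theorem ReadsFirst.coinAvg_append_eq {d : ℕ} {Y : (ℕ → Bool) → ℝ} (h : ReadsFirst d Y) (e : ℕ) :
    coinAvg (d + e) Y = coinAvg d Y := by
  rw [coinAvg_append]
  simp only [h.join, coinAvg_const]

/-- The variance of a sum of independent copies. -/
theorem coinAvg_sum_sq_le {d : ℕ} {Y : (ℕ → Bool) → ℝ} {μ v : ℝ} (hY : ReadsFirst d Y)
    (hμ : coinAvg d Y = μ) (hv : coinAvg d (fun ω => (Y ω - μ) ^ 2) ≤ v) (K : ℕ) :
    coinAvg (K * d) (fun ω => (∑ j ∈ Finset.range K, Y (shiftTape (j * d) ω) - K * μ) ^ 2) ≤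
      K * v := by
  induction K with
  | zero => simp [coinAvg_const]
  | succ K ih =>
    have hloc : ReadsFirst (K * d) fun ω => ∑ j ∈ Finset.range K, Y (shiftTape (j * d) ω) - K * μ :=
      fun ω ω' hω => by
        dsimp only
        congr 1
        refine Finset.sum_congr rfl fun j hj => ?_
        refine hY.shift (c := j * d) (e := K * d) ?_ ω ω' hω
        have := Finset.mem_range.1 hj
        nlinarith
    rw [Nat.succ_mul, coinAvg_append]
    -- Split off the last block. Its deviation has mean zero under the new coins, so the cross term
    -- vanishes.
    have e : ∀ ω ω', (∑ j ∈ Finset.range (K + 1), Y (shiftTape (j * d) (joinTape (K * d) ω ω')) -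
        ((K + 1 : ℕ) : ℝ) * μ) ^ 2 =
        (∑ j ∈ Finset.range K, Y (shiftTape (j * d) ω) - K * μ) ^ 2 +
        (2 * (∑ j ∈ Finset.range K, Y (shiftTape (j * d) ω) - K * μ) * (Y ω' - μ) +
          (Y ω' - μ) ^ 2) := fun ω ω' => by
      rw [Finset.sum_range_succ, shiftTape_joinTape]
      have := hloc.join ω ω'
      rw [← this]
      push_cast
      ring
    simp only [e, coinAvg_add, coinAvg_const, coinAvg_const_mul, coinAvg_sub, hμ, sub_self,
      mul_zero, zero_add]
    push_cast
    linarith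

/-! ### Random bits and random sets -/

/-- The dyadic number in `[0, 1)` given by the first `L` coins. -/
noncomputable def dyadic (ω : ℕ → Bool) : ℕ → ℝ
  | 0 => 0
  | L + 1 => (dyadic ω L + if ω L then 1 else 0) / 2

theorem dyadic_mem (ω : ℕ → Bool) (L : ℕ) : 0 ≤ dyadic ω L ∧ dyadic ω L < 1 := by
  induction L with
  | zero => simp [dyadic]
  | succ L ih =>
    unfold dyadic
    split_ifs <;> constructor <;> linarith [ih.1, ih.2]

theorem readsFirst_dyadic (L : ℕ) : ReadsFirst L fun ω => dyadic ω L := by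
  induction L with
  | zero => intro ω ω' _; simp [dyadic]
  | succ L ih =>
    intro ω ω' h
    have := ih ω ω' fun i hi => h i (by omega)
    dsimp only at this ⊢
    rw [dyadic, dyadic, this, h L (by omega)]

/-- The probability that the dyadic number given by `L` coins is less than `x`. -/
noncomputable def dyadicProb (L : ℕ) (x : ℝ) : ℝ :=
  coinAvg L fun ω => if dyadic ω L < x then 1 else 0

theorem dyadicProb_eq_zero (L : ℕ) {x : ℝ} (hx : x ≤ 0) : dyadicProb L x = 0 := by
  unfold dyadicProb
  have : ∀ ω, ¬ dyadic ω L < x := fun ω => by linarith [dyadic_mem ω L]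
  simp only [this, if_false, coinAvg_const]

theorem dyadicProb_eq_one (L : ℕ) {x : ℝ} (hx : 1 ≤ x) : dyadicProb L x = 1 := by
  unfold dyadicProb
  have : ∀ ω, dyadic ω L < x := fun ω => by linarith [dyadic_mem ω L]
  simp only [this, if_true, coinAvg_const]

theorem dyadicProb_mem (L : ℕ) (x : ℝ) : 0 ≤ dyadicProb L x ∧ dyadicProb L x ≤ 1 := by
  unfold dyadicProb
  constructor
  · refine (coinAvg_const L 0).symm.le.trans (coinAvg_mono fun ω => ?_)
    split_ifs <;> norm_num
  · refine (coinAvg_mono fun ω => ?_).trans (coinAvg_const L 1).le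
    split_ifs <;> norm_num

/-- The last coin flipped is the leading binary digit; condition on it. -/
theorem dyadicProb_succ (L : ℕ) (x : ℝ) :
    dyadicProb (L + 1) x = (dyadicProb L (2 * x - 1) + dyadicProb L (2 * x)) / 2 := by
  unfold dyadicProb
  rw [coinAvg_append]
  simp only [coinAvg_one]
  have e : ∀ (b : Bool) ω, (dyadic (joinTape L ω (tape fun _ : Fin 1 => b)) (L + 1) < x) ↔
      dyadic ω L < 2 * x - if b then 1 else 0 := fun b ω => by
    have h1 := (readsFirst_dyadic L).join ω (tape fun _ : Fin 1 => b)
    rw [dyadic, h1]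
    have h2 : joinTape L ω (tape fun _ : Fin 1 => b) L = b := by simp [joinTape, tape]
    rw [h2, div_lt_iff₀ (by norm_num)]
    constructor <;> intro h <;> linarith
  simp only [e, if_true, Bool.false_eq_true, if_false, sub_zero, div_eq_mul_inv, add_mul,
    coinAvg_add]
  simp only [mul_comm _ (2⁻¹ : ℝ), coinAvg_const_mul]

theorem abs_dyadicProb_sub_le (L : ℕ) {x : ℝ} (hx0 : 0 ≤ x) (hx1 : x ≤ 1) :
    |dyadicProb L x - x| ≤ (1 / 2) ^ L := by
  induction L generalizing x with
  | zero =>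
    have := dyadicProb_mem 0 x
    rw [pow_zero, abs_le]
    constructor <;> linarith
  | succ L ih =>
    rw [dyadicProb_succ, pow_succ]
    -- One of the two terms is exactly `0` or `1`, so only the other carries an error, and that
    -- error is halved.
    rcases le_total (2 * x) 1 with h | h
    · rw [dyadicProb_eq_zero L (by linarith)]
      have := abs_le.1 (ih (x := 2 * x) (by linarith) h)
      rw [abs_le]
      constructor <;> linarith
    · rw [dyadicProb_eq_one L h]
      have := abs_le.1 (ih (x := 2 * x - 1) (by linarith) (by linarith))
      rw [abs_le]
      constructor <;> linarith

open Classical in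
/-- A random set of elements `u < j`; each of them uses `L` coins and is taken with probability
about `x u`. -/
noncomputable def sampleBelow {n : ℕ} (x : Fin n → ℝ) (L j : ℕ) (ω : ℕ → Bool) :
    Finset (Fin n) :=
  Finset.univ.filter fun u : Fin n => (u : ℕ) < j ∧ dyadic (shiftTape (u * L) ω) L < x u

/-- A random set that uses `n * L` coins. -/
noncomputable def sampleSet {n : ℕ} (x : Fin n → ℝ) (L : ℕ) (ω : ℕ → Bool) : Finset (Fin n) :=
  sampleBelow x L n ω

theorem readsFirst_sampleBelow {n : ℕ} (x : Fin n → ℝ) (L j : ℕ) :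
    ReadsFirst (j * L) (sampleBelow x L j) := by
  intro ω ω' h
  ext u
  simp only [sampleBelow, Finset.mem_filter, Finset.mem_univ, true_and]
  refine and_congr_right fun hu => ?_
  have := (readsFirst_dyadic L).shift (c := u * L) (e := j * L) (by nlinarith) ω ω' h
  dsimp only at this
  rw [this]

/-- Deciding one more element with fresh coins averages `g` over inserting it or not, which is how
the multilinear extension changes when that coordinate moves from zero to the probability. -/
theorem coinAvg_sampleBelow {n : ℕ} (g : Finset (Fin n) → ℝ) (x : Fin n → ℝ) (L j : ℕ)
    (hj : j ≤ n) :
    coinAvg (j * L) (fun ω => g (sampleBelow x L j ω)) =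
      multilinearExt g (hybrid 0 (fun u => dyadicProb L (x u)) j) := by
  induction j generalizing g with
  | zero =>
    have h1 : hybrid 0 (fun u => dyadicProb L (x u)) 0 = (0 : Fin n → ℝ) := by
      ext u; simp [hybrid]
    have h2 : ∀ ω, sampleBelow x L 0 ω = ∅ := fun ω => by ext u; simp [sampleBelow]
    rw [h1]
    simp only [h2, coinAvg_const]
    rw [multilinearExt_congr (h := fun _ => g ∅), multilinearExt_const]
    intro S hS
    rw [Finset.eq_empty_of_forall_notMem fun u hu => hS u hu rfl]
  | succ j ih =>
    have hj' : j < n := hj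
    set i : Fin n := ⟨j, hj'⟩ with hi
    set y := hybrid 0 (fun u => dyadicProb L (x u)) j with hy
    have hs : ∀ ω ω', g (sampleBelow x L (j + 1) (joinTape (j * L) ω ω')) =
        (if dyadic ω' L < x i then 1 else 0) *
          (g (insert i (sampleBelow x L j ω)) - g (sampleBelow x L j ω)) +
          g (sampleBelow x L j ω) := fun ω ω' => by
      have h1 := (readsFirst_sampleBelow x L j).join ω ω'
      have h2 : sampleBelow x L (j + 1) (joinTape (j * L) ω ω') =
          if dyadic ω' L < x i then insert i (sampleBelow x L j ω) else sampleBelow x L j ω := by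
        rw [← h1]
        ext u
        have hiu : u = i ↔ (u : ℕ) = j := by rw [hi, Fin.ext_iff]
        by_cases hu : (u : ℕ) = j
        · have hu' : u = i := hiu.2 hu
          have hi' : (i : ℕ) = j := rfl
          split_ifs with h <;>
          simp [sampleBelow, hu', hi', shiftTape_joinTape, h]
        · have hlt : (u : ℕ) < j + 1 ↔ (u : ℕ) < j := by omega
          split_ifs with h <;>
          simp only [sampleBelow, Finset.mem_insert, Finset.mem_filter, Finset.mem_univ, true_and,
            hlt, mt hiu.1 hu, false_or]
      rw [h2]
      split_ifs <;> ring
    have hq : coinAvg L (fun ω' => if dyadic ω' L < x i then (1 : ℝ) else 0) =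
        dyadicProb L (x i) := rfl
    rw [Nat.succ_mul, coinAvg_append]
    simp only [hs, coinAvg_add, coinAvg_const]
    simp only [mul_comm (ite _ _ _), coinAvg_const_mul, hq]
    rw [ih g hj'.le]
    simp only [mul_comm _ (dyadicProb L (x i)), coinAvg_const_mul, coinAvg_sub]
    rw [ih g hj'.le, ih (fun S => g (insert i S)) hj'.le]
    have h3 := hybrid_succ 0 (fun u => dyadicProb L (x u)) i
    -- Coordinate `i` of `y` is still zero, so erasing `i` has no effect on the sets that count.
    have h4 : multilinearExt (fun S => g (S.erase i)) y = multilinearExt g y :=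
      multilinearExt_congr fun S hS => by
        rw [Finset.erase_eq_of_notMem]
        intro hc
        exact hS i hc (by simp [hy, hybrid, hi])
    change hybrid 0 _ (j + 1) = Function.update y i _ at h3
    rw [h3, multilinearExt_update, h4]
    ring

theorem coinAvg_sampleSet {n : ℕ} (g : Finset (Fin n) → ℝ) (x : Fin n → ℝ) (L : ℕ) :
    coinAvg (n * L) (fun ω => g (sampleSet x L ω)) =
      multilinearExt g (fun u => dyadicProb L (x u)) := by
  have := coinAvg_sampleBelow g x L n le_rfl
  have h : hybrid 0 (fun u => dyadicProb L (x u)) n = fun u => dyadicProb L (x u) := by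
    ext u; simp [hybrid]
  rwa [h] at this

/-! ### The sampled measured continuous greedy process -/

section GreedyProcess

variable {n : ℕ}

/-- The total gain, over `K` random sets, of changing the membership of `u`. -/
noncomputable def sampledGain (f : Finset (Fin n) → ℝ) (x : Fin n → ℝ) (L K : ℕ)
    (ω : ℕ → Bool) (u : Fin n) : ℝ :=
  ∑ j ∈ Finset.range K, toggleGain f u (sampleSet x L (shiftTape (j * (n * L)) ω))

/-- One step of length `δ`. -/
noncomputable def greedyStep (f : Finset (Fin n) → ℝ) (p : Fin n → ℝ) (B : ℝ) (L K : ℕ) (δ : ℝ)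
    (x : Fin n → ℝ) (ω : ℕ → Bool) : Fin n → ℝ :=
  fun u => x u + δ * (1 - 2 * x u) * fracKnapsack p B (sampledGain f x L K ω) u

/-- The point reached after `k` steps. -/
noncomputable def greedyPoint (f : Finset (Fin n) → ℝ) (p : Fin n → ℝ) (B : ℝ) (L K : ℕ) (δ : ℝ)
    (ω : ℕ → Bool) : ℕ → Fin n → ℝ
  | 0 => 0
  | k + 1 => greedyStep f p B L K δ (greedyPoint f p B L K δ ω k)
      (shiftTape (k * (K * (n * L))) ω)

theorem readsFirst_sampledGain (f : Finset (Fin n) → ℝ) (x : Fin n → ℝ) (L K : ℕ) :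
    ReadsFirst (K * (n * L)) (sampledGain f x L K) := by
  intro ω ω' h
  ext u
  refine Finset.sum_congr rfl fun j hj => ?_
  have hj' := Finset.mem_range.1 hj
  have hle : j * (n * L) + n * L ≤ K * (n * L) := by
    rw [← Nat.succ_mul]; exact Nat.mul_le_mul_right _ hj'
  exact congrArg _ ((readsFirst_sampleBelow x L n).shift hle ω ω' h)

variable {f h : Finset (Fin n) → ℝ} {p : Fin n → ℝ} {B : ℝ} {L K : ℕ} {δ : ℝ}

theorem readsFirst_greedyStep (x : Fin n → ℝ) :
    ReadsFirst (K * (n * L)) (greedyStep f p B L K δ x) :=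
  (readsFirst_sampledGain f x L K).comp
    fun W u => x u + δ * (1 - 2 * x u) * fracKnapsack p B W u

theorem readsFirst_greedyPoint (k : ℕ) :
    ReadsFirst (k * (K * (n * L))) fun ω => greedyPoint f p B L K δ ω k := by
  induction k with
  | zero => intro ω ω' _; rfl
  | succ k ih =>
    intro ω ω' hω
    have h1 := ih ω ω' fun i hi => hω i (hi.trans_le (Nat.mul_le_mul_right _ (Nat.le_succ k)))
    have h2 := (readsFirst_greedyStep (f := f) (p := p) (B := B) (δ := δ)
      (greedyPoint f p B L K δ ω' k)).shift (c := k * (K * (n * L)))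
      (e := (k + 1) * (K * (n * L))) (by rw [← Nat.succ_mul]) ω ω' hω
    dsimp only at h1 h2 ⊢
    rw [greedyPoint, greedyPoint, h1, h2]

/-- The point of the measured factor: `1 - 2 x u` evolves multiplicatively, which keeps `x u ≤ 1/2`
and gives the exponential feasibility bound. -/
theorem one_sub_two_mul_greedyStep (x : Fin n → ℝ) (ω : ℕ → Bool) (u : Fin n) :
    1 - 2 * greedyStep f p B L K δ x ω u =
      (1 - 2 * x u) * (1 - 2 * δ * fracKnapsack p B (sampledGain f x L K ω) u) := by
  unfold greedyStep; ring

theorem greedyStep_mem (hδ : 0 ≤ δ) (hδ' : 2 * δ ≤ 1) {x : Fin n → ℝ}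
    (hx : ∀ u, 0 ≤ x u ∧ x u ≤ 1 / 2) (ω : ℕ → Bool) (u : Fin n) :
    0 ≤ greedyStep f p B L K δ x ω u ∧ greedyStep f p B L K δ x ω u ≤ 1 / 2 := by
  have hz := fracKnapsack_mem_Icc (p := p) (B := B) (w := sampledGain f x L K ω) u
  constructor
  · exact add_nonneg (hx u).1 (mul_nonneg (mul_nonneg hδ (by linarith [hx u])) hz.1)
  · have h1 := one_sub_two_mul_greedyStep (f := f) (p := p) (B := B) (L := L) (K := K) (δ := δ)
      x ω u
    have h2 : 0 ≤ (1 - 2 * x u) * (1 - 2 * δ * fracKnapsack p B (sampledGain f x L K ω) u) :=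
      mul_nonneg (by linarith [hx u]) (by nlinarith [hz.1, hz.2])
    linarith

theorem greedyPoint_mem (hδ : 0 ≤ δ) (hδ' : 2 * δ ≤ 1) (ω : ℕ → Bool) (k : ℕ) (u : Fin n) :
    0 ≤ greedyPoint f p B L K δ ω k u ∧ greedyPoint f p B L K δ ω k u ≤ 1 / 2 := by
  induction k generalizing u with
  | zero => simp [greedyPoint]
  | succ k ih => exact greedyStep_mem hδ hδ' ih _ u

theorem greedyPoint_eq_zero (ω : ℕ → Bool) (k : ℕ) {u : Fin n} (hu : ¬ p u ≤ B) :
    greedyPoint f p B L K δ ω k u = 0 := by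
  induction k with
  | zero => rfl
  | succ k ih => simp [greedyPoint, greedyStep, ih, fracKnapsack_eq_zero hu]

theorem sampleSet_pos {x : Fin n → ℝ} {ω : ℕ → Bool} {u : Fin n} (hu : u ∈ sampleSet x L ω) :
    0 < x u := by
  simp only [sampleSet, sampleBelow, Finset.mem_filter] at hu
  exact (dyadic_mem _ _).1.trans_lt hu.2.2

/-- Only the values on sets of elements that fit into the budget matter. -/
theorem greedyPoint_congr (hfh : ∀ S : Finset (Fin n), (∀ u ∈ S, p u ≤ B) → f S = h S)
    (ω : ℕ → Bool) (k : ℕ) : greedyPoint f p B L K δ ω k = greedyPoint h p B L K δ ω k := by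
  induction k with
  | zero => rfl
  | succ k ih =>
    rw [greedyPoint, greedyPoint, ← ih]
    unfold greedyStep
    rw [fracKnapsack_congr (w' := sampledGain h (greedyPoint f p B L K δ ω k) L K
      (shiftTape (k * (K * (n * L))) ω))]
    intro u hu
    refine Finset.sum_congr rfl fun j _ => ?_
    have hS : ∀ v ∈ sampleSet (greedyPoint f p B L K δ ω k) L
        (shiftTape (j * (n * L)) (shiftTape (k * (K * (n * L))) ω)), p v ≤ B := fun v hv => by
      by_contra hc
      exact (sampleSet_pos hv).ne' (greedyPoint_eq_zero ω k hc)
    unfold toggleGain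
    rw [hfh _ hS, hfh]
    intro v hv
    unfold toggle at hv
    split_ifs at hv
    · exact hS v (Finset.mem_of_mem_erase hv)
    · rcases Finset.mem_insert.1 hv with rfl | hv
      exacts [hu, hS v hv]

theorem abs_toggleGain_le {C : ℝ} (h0 : ∀ S, 0 ≤ h S) (hC : ∀ S, h S ≤ C) (u : Fin n)
    (S : Finset (Fin n)) : |toggleGain h u S| ≤ C := by
  unfold toggleGain
  rw [abs_le]
  constructor <;> linarith [h0 S, hC S, h0 (toggle u S), hC (toggle u S)]

/-- The mean error of the estimate of the gains from `s ^ 2` samples. -/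
theorem coinAvg_abs_sampledGain_le {C : ℝ} {s : ℕ} (hs : 0 < s) (hC0 : 0 < C)
    (h0 : ∀ S, 0 ≤ h S) (hC : ∀ S, h S ≤ C) {x : Fin n → ℝ} (hx : ∀ u, 0 ≤ x u ∧ x u ≤ 1)
    (u : Fin n) :
    coinAvg (s ^ 2 * (n * L)) (fun ω => |multilinearExt (toggleGain h u) x -
      sampledGain h x L (s ^ 2) ω u / (s ^ 2 : ℕ)|) ≤ 2 * C * n * (1 / 2) ^ L + C / s := by
  have hg := abs_toggleGain_le h0 hC u
  set q : Fin n → ℝ := fun u => dyadicProb L (x u) with hq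
  set μ := multilinearExt (toggleGain h u) q with hμ
  -- Bias: with `L` coins an element is drawn with a probability that differs from `x v` by up to
  -- `(1/2) ^ L`.
  have hbias : |multilinearExt (toggleGain h u) x - μ| ≤ 2 * C * n * (1 / 2) ^ L := by
    refine (abs_multilinearExt_sub_le (fun v => dyadicProb_mem L (x v)) hx hg).trans ?_
    rw [mul_assoc (2 * C)]
    refine mul_le_mul_of_nonneg_left ?_ (by positivity)
    refine (Finset.sum_le_card_nsmul _ _ ((1 / 2) ^ L) fun v _ => ?_).trans (by simp)
    rw [abs_sub_comm]
    exact abs_dyadicProb_sub_le L (hx v).1 (hx v).2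
  set Y : (ℕ → Bool) → ℝ := fun ω => toggleGain h u (sampleSet x L ω) with hY
  have hYr : ReadsFirst (n * L) Y := (readsFirst_sampleBelow x L n).comp _
  have hYμ : coinAvg (n * L) Y = μ := coinAvg_sampleSet _ x L
  have hYv : coinAvg (n * L) (fun ω => (Y ω - μ) ^ 2) ≤ C ^ 2 := by
    have e : ∀ ω, (Y ω - μ) ^ 2 = Y ω ^ 2 - 2 * μ * Y ω + μ ^ 2 := fun ω => by ring
    have h1 : coinAvg (n * L) (fun ω => Y ω ^ 2) ≤ C ^ 2 := by
      rw [← coinAvg_const (n * L) (C ^ 2)]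
      exact coinAvg_mono fun ω => sq_le_sq' (abs_le.1 (hg _)).1 (abs_le.1 (hg _)).2
    simp only [e, coinAvg_add, coinAvg_sub, coinAvg_const_mul, coinAvg_const, hYμ]
    nlinarith [sq_nonneg μ]
  have hvar := coinAvg_sum_sq_le hYr hYμ hYv (s ^ 2)
  have hs' : (0 : ℝ) < s := by exact_mod_cast hs
  have hpt : ∀ ω, |multilinearExt (toggleGain h u) x -
      sampledGain h x L (s ^ 2) ω u / (s ^ 2 : ℕ)| ≤
      (2 * C * n * (1 / 2) ^ L + C / s / 2) + (1 / (2 * C * s ^ 3)) *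
        (∑ j ∈ Finset.range (s ^ 2), Y (shiftTape (j * (n * L)) ω) - (s ^ 2 : ℕ) * μ) ^ 2 := by
    intro ω
    set D := ∑ j ∈ Finset.range (s ^ 2), Y (shiftTape (j * (n * L)) ω) - (s ^ 2 : ℕ) * μ with hD
    have e : multilinearExt (toggleGain h u) x - sampledGain h x L (s ^ 2) ω u / (s ^ 2 : ℕ) =
        (multilinearExt (toggleGain h u) x - μ) - D / (s ^ 2 : ℕ) := by
      have : sampledGain h x L (s ^ 2) ω u =
        ∑ j ∈ Finset.range (s ^ 2), Y (shiftTape (j * (n * L)) ω) := rfl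
      rw [this, hD]
      push_cast
      field_simp
      ring
    -- The inequality of arithmetic and geometric means bounds the absolute error by the squared
    -- one. The weights are balanced for `D ^ 2` of mean at most `s ^ 2 * C ^ 2`, so that both terms
    -- contribute `C / (2 s)`.
    have hy : |D / (s ^ 2 : ℕ)| ≤ C / s / 2 + (1 / (2 * C * s ^ 3)) * D ^ 2 := by
      have e2 : C / s / 2 + (1 / (2 * C * s ^ 3)) * D ^ 2 - |D / (s ^ 2 : ℕ)| =
          (C * s - |D|) ^ 2 / (2 * C * s ^ 3) := by
        push_cast
        rw [abs_div, abs_of_pos (by positivity : (0 : ℝ) < (s : ℝ) ^ 2), ← sq_abs D]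
        field_simp
        ring
      have : 0 ≤ (C * s - |D|) ^ 2 / (2 * C * s ^ 3) := by positivity
      linarith
    rw [e]
    linarith [abs_sub (multilinearExt (toggleGain h u) x - μ) (D / (s ^ 2 : ℕ))]
  refine (coinAvg_mono hpt).trans ?_
  rw [coinAvg_add, coinAvg_const, coinAvg_const_mul]
  have h2 := mul_le_mul_of_nonneg_left hvar (by positivity : 0 ≤ 1 / (2 * C * (s : ℝ) ^ 3))
  have h3 : 1 / (2 * C * (s : ℝ) ^ 3) * ((s ^ 2 : ℕ) * C ^ 2) = C / s / 2 := by
    push_cast; field_simp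
  linarith

/-- The relative loss, per unit of time, of the process with `s ^ 2` samples of precision `L`. -/
noncomputable def stepLoss (n s L : ℕ) (C δ : ℝ) : ℝ :=
  2 * C * n ^ 2 * δ + 2 * n * (2 * C * n * (1 / 2) ^ L + C / s)

/-- Averaging the hypothesis `hV` over `x` turns the gains over `O` into `V - 2 F x`, and the
knapsack direction does as well as `O` for the estimated gains. Submodularity and symmetry enter
only through `hV`, so the lemma also applies to a truncation of `f` that need not be symmetric. -/
theorem coinAvg_greedyStep_ge {C V : ℝ} {s : ℕ} (hs : 0 < s) (hC0 : 0 < C) (hδ : 0 ≤ δ)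
    (hδ' : 2 * δ ≤ 1) (h0 : ∀ S, 0 ≤ h S) (hC : ∀ S, h S ≤ C) (hp : ∀ u, 0 ≤ p u)
    {O : Finset (Fin n)} (hO : charVec O ∈ knapsackPolytope p B)
    (hV : ∀ R, V - 2 * h R ≤ ∑ u ∈ O, toggleGain h u R) {x : Fin n → ℝ}
    (hx : ∀ u, 0 ≤ x u ∧ x u ≤ 1 / 2) :
    (1 - 2 * δ) * multilinearExt h x + δ * (V - stepLoss n s L C δ) ≤
      coinAvg (s ^ 2 * (n * L))
        (fun ω => multilinearExt h (greedyStep h p B L (s ^ 2) δ x ω)) := by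
  have hx1 : ∀ u, 0 ≤ x u ∧ x u ≤ 1 := fun u => ⟨(hx u).1, by linarith [hx u]⟩
  set G : Fin n → ℝ := fun u => multilinearExt (toggleGain h u) x with hG
  set E : (ℕ → Bool) → Fin n → ℝ :=
    fun ω u => G u - sampledGain h x L (s ^ 2) ω u / (s ^ 2 : ℕ) with hE
  have hs' : (0 : ℝ) < (s ^ 2 : ℕ) := by exact_mod_cast pow_pos hs 2
  have hB : 0 ≤ B := (Finset.sum_nonneg fun u _ => mul_nonneg (hp u) (hO.1 u).1).trans hO.2
  have hOB : ∀ u, ¬ p u ≤ B → charVec O u = 0 := by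
    intro u hu
    by_contra hc
    have h1 : charVec O u = 1 := by
      unfold charVec at hc ⊢
      split_ifs at hc ⊢ with hm
      · rfl
      · exact absurd rfl hc
    have := (Finset.single_le_sum (f := fun u => p u * charVec O u)
      (fun v _ => mul_nonneg (hp v) (hO.1 v).1) (Finset.mem_univ u)).trans hO.2
    simp only [h1, mul_one] at this
    exact hu this
  have hGO : V - 2 * multilinearExt h x ≤ ∑ u ∈ O, G u := by
    have h1 := multilinearExt_mono (g := fun R => V - 2 * h R) hx1 hV
    rwa [multilinearExt_sub, multilinearExt_const, multilinearExt_const_mul,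
      multilinearExt_sum] at h1
  have hpt : ∀ ω, multilinearExt h x + δ * (V - 2 * multilinearExt h x) -
      2 * C * n ^ 2 * δ ^ 2 - δ * 2 * ∑ u, |E ω u| ≤
      multilinearExt h (greedyStep h p B L (s ^ 2) δ x ω) := by
    intro ω
    set W := sampledGain h x L (s ^ 2) ω with hW
    set z := fracKnapsack p B W with hz
    have hzm : ∀ u, 0 ≤ z u ∧ z u ≤ 1 := fun u => fracKnapsack_mem_Icc u
    have hstep := multilinearExt_step_ge hδ h0 hC hx1 (z := z) (fun u => by
      have := greedyStep_mem (f := h) (p := p) (B := B) (L := L) (K := s ^ 2) hδ hδ' hx ω u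
      exact ⟨this.1, this.2.trans (by norm_num)⟩) hzm
    have hopt := le_sum_fracKnapsack (w := W) hp hB hO.1 hO.2 hOB
    have hc : ∑ u, W u * charVec O u = ∑ u ∈ O, W u := by
      simp [charVec]
    rw [hc] at hopt
    have e1 : ∀ u, G u = W u / (s ^ 2 : ℕ) + E ω u := fun u => by simp only [hE, hW]; ring
    have h1 : ∑ u, z u * G u ≥ (∑ u, W u * z u) / (s ^ 2 : ℕ) - ∑ u, |E ω u| := by
      rw [Finset.sum_div, ← Finset.sum_sub_distrib]
      refine Finset.sum_le_sum fun u _ => ?_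
      have h2 : -|E ω u| ≤ z u * E ω u := by
        have : |z u * E ω u| ≤ |E ω u| := by
          rw [abs_mul, abs_of_nonneg (hzm u).1]
          exact mul_le_of_le_one_left (abs_nonneg _) (hzm u).2
        exact (neg_le_neg this).trans (neg_abs_le _)
      rw [e1 u, mul_add, mul_div_assoc', mul_comm (z u) (W u)]
      linarith
    have h3 : ∑ u ∈ O, G u ≤ (∑ u ∈ O, W u) / (s ^ 2 : ℕ) + ∑ u, |E ω u| := by
      simp only [e1]
      rw [Finset.sum_add_distrib, Finset.sum_div]
      have : ∑ u ∈ O, E ω u ≤ ∑ u, |E ω u| :=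
        (Finset.sum_le_sum fun u _ => le_abs_self _).trans
          (Finset.sum_le_sum_of_subset_of_nonneg (Finset.subset_univ O) fun _ _ _ => abs_nonneg _)
      linarith
    have h4 : (∑ u ∈ O, W u) / (s ^ 2 : ℕ) ≤ (∑ u, W u * z u) / (s ^ 2 : ℕ) :=
      div_le_div_of_nonneg_right hopt hs'.le
    -- The estimation error is paid twice: in passing from true to estimated gains for `O`, and back
    -- again for the chosen direction.
    have h5 : V - 2 * multilinearExt h x - 2 * ∑ u, |E ω u| ≤ ∑ u, z u * G u := by linarith
    have h6 := mul_le_mul_of_nonneg_left h5 hδ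
    refine le_trans ?_ hstep
    linarith
  refine le_trans ?_ (coinAvg_mono hpt)
  rw [coinAvg_sub, coinAvg_const, coinAvg_const_mul, coinAvg_sum]
  have h7 : ∑ u, coinAvg (s ^ 2 * (n * L)) (fun ω => |E ω u|) ≤
      n * (2 * C * n * (1 / 2) ^ L + C / s) := by
    refine (Finset.sum_le_card_nsmul _ _ _ fun u _ =>
      coinAvg_abs_sampledGain_le hs hC0 h0 hC hx1 u).trans_eq ?_
    rw [Finset.card_univ, Fintype.card_fin, nsmul_eq_mul]
  have h8 := mul_le_mul_of_nonneg_left h7 (by positivity : 0 ≤ δ * 2)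
  unfold stepLoss
  linarith

/-- The step bound is an affine recursion with fixed point `(V - stepLoss n s L C δ) / 2` and
contraction factor `1 - 2 * δ`, started from a nonnegative value. -/
theorem coinAvg_greedyPoint_ge {C V : ℝ} {s : ℕ} (hs : 0 < s) (hC0 : 0 < C) (hδ : 0 ≤ δ)
    (hδ' : 2 * δ ≤ 1) (h0 : ∀ S, 0 ≤ h S) (hC : ∀ S, h S ≤ C) (hp : ∀ u, 0 ≤ p u)
    {O : Finset (Fin n)} (hO : charVec O ∈ knapsackPolytope p B)
    (hV : ∀ R, V - 2 * h R ≤ ∑ u ∈ O, toggleGain h u R) (k : ℕ) :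
    (V - stepLoss n s L C δ) / 2 * (1 - (1 - 2 * δ) ^ k) ≤
      coinAvg (k * (s ^ 2 * (n * L)))
        (fun ω => multilinearExt h (greedyPoint h p B L (s ^ 2) δ ω k)) := by
  induction k with
  | zero =>
    simp only [pow_zero, sub_self, mul_zero]
    rw [← coinAvg_const (0 * (s ^ 2 * (n * L))) 0]
    exact coinAvg_mono fun ω => multilinearExt_nonneg (fun u => by simp [greedyPoint]) h0
  | succ k ih =>
    set b := s ^ 2 * (n * L) with hb
    rw [Nat.succ_mul, coinAvg_append]
    have e : ∀ ω ω', greedyPoint h p B L (s ^ 2) δ (joinTape (k * b) ω ω') (k + 1) =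
        greedyStep h p B L (s ^ 2) δ (greedyPoint h p B L (s ^ 2) δ ω k) ω' := fun ω ω' => by
      rw [greedyPoint, ← hb, shiftTape_joinTape]
      congr 1
      exact (readsFirst_greedyPoint k).join ω ω'
    simp only [e]
    have hstep := fun ω => coinAvg_greedyStep_ge (L := L) hs hC0 hδ hδ' h0 hC hp hO hV
      (fun u => greedyPoint_mem (f := h) (p := p) (B := B) (L := L) (K := s ^ 2) hδ hδ' ω k u)
    refine le_trans ?_ (coinAvg_mono hstep)
    rw [coinAvg_add, coinAvg_const_mul, coinAvg_const]
    have := mul_le_mul_of_nonneg_left ih (by linarith : 0 ≤ 1 - 2 * δ)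
    rw [pow_succ]
    linarith

/-- The value of the process compared with a best integral solution. -/
theorem coinAvg_greedyPoint_ge_of_isIntegralOpt {s m : ℕ} (hn : 1 ≤ n) (hs : 0 < s) (hδ : 0 ≤ δ)
    (hδ' : 2 * δ ≤ 1) (h0 : ∀ S, 0 ≤ f S) (hf : IsSubmodular f) (hsym : IsSymmetricSetFun f)
    (hp : ∀ u, 0 ≤ p u) {O : Finset (Fin n)} (hO : IsIntegralOpt f (knapsackPolytope p B) O)
    (k : ℕ) (hm : k * (s ^ 2 * (n * L)) ≤ m) :
    (1 - stepLoss n s L n δ) / 2 * (1 - (1 - 2 * δ) ^ k) * f O ≤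
      coinAvg m (fun ω => multilinearExt f (greedyPoint f p B L (s ^ 2) δ ω k)) := by
  classical
  have hB : 0 ≤ B :=
    (Finset.sum_nonneg fun u _ => mul_nonneg (hp u) (hO.1.1 u).1).trans hO.1.2
  have hpt : ∀ ω, ∀ u, 0 ≤ greedyPoint f p B L (s ^ 2) δ ω k u ∧
      greedyPoint f p B L (s ^ 2) δ ω k u ≤ 1 := fun ω u =>
    ⟨(greedyPoint_mem hδ hδ' ω k u).1, (greedyPoint_mem hδ hδ' ω k u).2.trans (by norm_num)⟩
  -- The bound `C = n * f O` must be positive for the sampling estimate, so a vanishing optimum is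
  -- treated separately.
  rcases (h0 O).eq_or_lt with hz | hpos
  · rw [← hz, mul_zero, ← coinAvg_const m 0]
    exact coinAvg_mono fun ω => multilinearExt_nonneg (hpt ω) h0
  have hchar : ∀ S : Finset (Fin n), ∑ u, p u * charVec S u = ∑ u ∈ S, p u := fun S => by
    simp [charVec]
  have hmem : ∀ S : Finset (Fin n), ∑ u ∈ S, p u ≤ B → charVec S ∈ knapsackPolytope p B :=
    fun S hS => ⟨fun u => by unfold charVec; split_ifs <;> norm_num, by rwa [hchar]⟩
  have hOB : ∀ u ∈ O, p u ≤ B := fun u hu => by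
    refine (Finset.single_le_sum (fun v _ => hp v) hu).trans ?_
    rw [← hchar]; exact hO.1.2
  set E : Finset (Fin n) := Finset.univ.filter fun u => p u ≤ B with hE
  have hEmem : ∀ u, u ∈ E ↔ p u ≤ B := fun u => by simp [hE]
  -- A set containing an element too costly for the budget may have a value far above `f O`. The
  -- truncation `g` forgets such elements, and the process does not notice the difference.
  set g : Finset (Fin n) → ℝ := fun S => f (S ∩ E) with hg
  have hfg : ∀ S : Finset (Fin n), (∀ u ∈ S, p u ≤ B) → f S = g S := fun S hS => by
    simp only [hg]
    rw [Finset.inter_eq_left.2 fun u hu => (hEmem u).2 (hS u hu)]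
  -- The empty set and the affordable singletons are feasible, hence have value at most `f O`.
  have hgC : ∀ S, g S ≤ n * f O := fun S =>
    hf.le_card_mul h0 _ hn (hO.2 _ (hmem _ (by simpa using hB))) fun u hu =>
      hO.2 _ (hmem _ (by simpa using (hEmem u).1 (Finset.mem_inter.1 hu).2))
  have hgV : ∀ R, f O - 2 * g R ≤ ∑ u ∈ O, toggleGain g u R := fun R => by
    refine (le_sum_toggleGain hf h0 hsym (R ∩ E) O).trans_eq (Finset.sum_congr rfl fun u hu => ?_)
    have huE := (hEmem u).2 (hOB u hu)
    have : toggle u (R ∩ E) = toggle u R ∩ E := by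
      unfold toggle
      by_cases huR : u ∈ R
      · rw [if_pos huR, if_pos (Finset.mem_inter.2 ⟨huR, huE⟩)]
        ext v; simp
      · rw [if_neg huR, if_neg fun e => huR (Finset.mem_inter.1 e).1,
          Finset.insert_inter_of_mem huE]
    simp only [toggleGain, hg, this]
  have hn' : (0 : ℝ) < n := by exact_mod_cast hn
  have key := coinAvg_greedyPoint_ge (L := L) hs (mul_pos hn' hpos) hδ hδ' (fun S => h0 _) hgC hp
    hO.1 hgV k
  have e1 : ∀ ω, multilinearExt f (greedyPoint f p B L (s ^ 2) δ ω k) =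
      multilinearExt g (greedyPoint g p B L (s ^ 2) δ ω k) := fun ω => by
    rw [← greedyPoint_congr hfg]
    refine multilinearExt_congr fun S hS => hfg S fun u hu => ?_
    by_contra hc
    exact hS u hu (greedyPoint_eq_zero ω k hc)
  obtain ⟨d, rfl⟩ := Nat.exists_eq_add_of_le hm
  rw [ReadsFirst.coinAvg_append_eq]
  · simp only [e1]
    refine le_trans (le_of_eq ?_) key
    unfold stepLoss
    ring
  · exact (readsFirst_greedyPoint k).comp _

/-- Feasibility of the points of the process. -/
theorem greedyPoint_mem_bicriteriaFeasible {θ : ℝ} (hp : ∀ u, 0 ≤ p u) (hc : 0 < density p B)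
    (hc1 : density p B < 1) (hθ : 0 < θ) (hθ1 : θ ≤ 1) (hδ : 0 ≤ δ) (hδ' : 2 * δ ≤ 1)
    (ω : ℕ → Bool) (k : ℕ) (hk : θ ≤ (1 - 2 * δ) ^ k) :
    greedyPoint f p B L K δ ω k ∈ bicriteriaFeasible (knapsackPolytope p B)
      ((1 - θ ^ density p B) / (2 * density p B)) := by
  obtain ⟨-, hB, -⟩ := budget_eq_density_mul hp hc
  rcases Nat.eq_zero_or_pos k with rfl | hk0
  · refine mem_bicriteriaFeasible_of_rpow_le (b := 0) hp hc hc1 hθ hθ1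
      ⟨fun u => by simp, by simpa using hB.le⟩ (fun u => by simp [greedyPoint])
      (fun u => by simp [greedyPoint])
  have hρ : 0 < 1 - 2 * δ := by
    rcases (by linarith : 0 ≤ 1 - 2 * δ).eq_or_lt with h | h
    · rw [← h, zero_pow hk0.ne'] at hk; linarith
    · exact h
  -- The vector `a` accumulates the directions of the first `k` steps; Bernoulli's inequality
  -- compares the factor `1 - 2 * δ * z u` with a power of `1 - 2 * δ`.
  have hsum : ∀ k : ℕ, ∃ a : Fin n → ℝ, (∀ u, 0 ≤ a u ∧ a u ≤ k) ∧ ∑ u, p u * a u ≤ k * B ∧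
      ∀ u, (1 - 2 * δ) ^ a u ≤ 1 - 2 * greedyPoint f p B L K δ ω k u := by
    intro k
    induction k with
    | zero => exact ⟨0, by simp, by simp, by simp [greedyPoint]⟩
    | succ k ih =>
      obtain ⟨a, ha, hap, hax⟩ := ih
      set z := fracKnapsack p B (sampledGain f (greedyPoint f p B L K δ ω k) L K
        (shiftTape (k * (K * (n * L))) ω)) with hz
      have hzm : ∀ u, 0 ≤ z u ∧ z u ≤ 1 := fun u => fracKnapsack_mem_Icc u
      refine ⟨fun u => a u + z u, fun u => ?_, ?_, fun u => ?_⟩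
      · push_cast
        constructor <;> linarith [ha u, hzm u]
      · simp only [mul_add, Finset.sum_add_distrib]
        have : ∑ u, p u * z u ≤ B := sum_fracKnapsack_le hp hB.le
        push_cast
        linarith
      · rw [greedyPoint, one_sub_two_mul_greedyStep, Real.rpow_add hρ]
        have hber : (1 - 2 * δ) ^ z u ≤ 1 - 2 * δ * z u := by
          have := rpow_one_add_le_one_add_mul_self (s := -(2 * δ)) (by linarith) (hzm u).1
            (hzm u).2
          rw [← sub_eq_add_neg] at this
          linarith
        exact mul_le_mul (hax u) hber (Real.rpow_nonneg hρ.le _)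
          (by linarith [greedyPoint_mem (f := f) (p := p) (B := B) (L := L) (K := K) hδ hδ' ω k u])
  obtain ⟨a, ha, hap, hax⟩ := hsum k
  have hk' : (0 : ℝ) < k := by exact_mod_cast hk0
  -- The average of the directions lies in the polytope, and `θ ^ (a u / k) ≤ (1 - 2 * δ) ^ a u`
  -- since `θ ≤ (1 - 2 * δ) ^ k`.
  refine mem_bicriteriaFeasible_of_rpow_le (b := fun u => a u / k) hp hc hc1 hθ hθ1
    ⟨fun u => ⟨div_nonneg (ha u).1 hk'.le, (div_le_one hk').2 (ha u).2⟩, ?_⟩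
    (fun u => (greedyPoint_mem hδ hδ' ω k u).1) (fun u => le_trans ?_ (hax u))
  · simp only [mul_div_assoc', ← Finset.sum_div]
    rw [div_le_iff₀ hk']
    linarith
  · refine (Real.rpow_le_rpow hθ.le hk (div_nonneg (ha u).1 hk'.le)).trans_eq ?_
    rw [← Real.rpow_natCast, ← Real.rpow_mul hρ.le]
    congr 1
    field_simp

end GreedyProcess

/-! ### Total correctness with time bounds -/

namespace OracleRAM

section Rules

variable {n : ℕ} {f : Finset (Fin n) → ℝ} {ω : ℕ → Bool}

/-- The program halts within `T` steps in a state that satisfies `R`. -/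
def Halts (f : Finset (Fin n) → ℝ) (ω : ℕ → Bool) (P : Prog) (s : State) (T : ℕ)
    (R : State → Prop) : Prop :=
  ∃ t ≤ T, ∃ s', Exec f ω P s t s' ∧ R s'

variable {P Q : Prog} {s : State} {T T' : ℕ} {R R' : State → Prop}

theorem Halts.mono (h : Halts f ω P s T R) (hT : T ≤ T') (hR : ∀ s', R s' → R' s') :
    Halts f ω P s T' R' := by
  obtain ⟨t, ht, s', he, hs'⟩ := h
  exact ⟨t, ht.trans hT, s', he, hR s' hs'⟩

theorem Halts.weaken (h : Halts f ω P s T R) (hR : ∀ s', R s' → R' s') : Halts f ω P s T R' :=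
  h.mono le_rfl hR

theorem Halts.skip (h : R s) : Halts f ω .skip s 1 R := ⟨1, le_rfl, s, .skip s, h⟩

theorem Halts.setNat {i : ℕ} {e : NatExpr} (h : R (s.putNat i (e.eval s))) :
    Halts f ω (.setNat i e) s (e.cost + 1) R := ⟨_, le_rfl, _, .setNat s i e, h⟩

theorem Halts.setReal {a : ℕ} {i : NatExpr} {e : RealExpr}
    (h : R (s.putReal a (i.eval s) (e.eval s))) :
    Halts f ω (.setReal a i e) s (i.cost + e.cost + 1) R := ⟨_, le_rfl, _, .setReal s a i e, h⟩

theorem Halts.query {src a : ℕ} {i : NatExpr}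
    (h : R (s.putReal a (i.eval s) (f (s.markedSet n src)))) :
    Halts f ω (.query src a i) s (i.cost + 1) R := ⟨_, le_rfl, _, .query s src a i, h⟩

theorem Halts.flip {a : ℕ} {i : NatExpr}
    (h : R { s.putReal a (i.eval s) (if ω s.coins then 1 else 0) with coins := s.coins + 1 }) :
    Halts f ω (.flip a i) s (i.cost + 1) R := ⟨_, le_rfl, _, .flip s a i, h⟩

theorem Halts.seq (h : Halts f ω P s T fun s₁ => Halts f ω Q s₁ T' R) :
    Halts f ω (.seq P Q) s (T + T') R := by
  obtain ⟨t₁, h₁, s₁, e₁, t₂, h₂, s₂, e₂, hR⟩ := h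
  exact ⟨_, add_le_add h₁ h₂, s₂, .seq e₁ e₂, hR⟩

theorem Halts.bind {U : ℕ} {R₁ : State → Prop} (h : Halts f ω P s T R₁) (T' : ℕ) (hU : T + T' ≤ U)
    (h' : ∀ s₁, R₁ s₁ → Halts f ω Q s₁ T' R) : Halts f ω (.seq P Q) s U R :=
  (Halts.seq (h.weaken h')).mono hU fun _ hs => hs

theorem Halts.ite {b : Cond} (hP : b.holds s → Halts f ω P s T R)
    (hQ : ¬ b.holds s → Halts f ω Q s T' R) :
    Halts f ω (.ite b P Q) s (b.cost + max T T') R := by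
  by_cases hb : b.holds s
  · obtain ⟨t, ht, s', e, hR⟩ := hP hb
    exact ⟨_, Nat.add_le_add_left (ht.trans (le_max_left _ _)) _, s', .iteTrue hb e, hR⟩
  · obtain ⟨t, ht, s', e, hR⟩ := hQ hb
    exact ⟨_, Nat.add_le_add_left (ht.trans (le_max_right _ _)) _, s', .iteFalse hb e, hR⟩

/-- The invariant `I k` holds just before the test for iteration `k`, and the test succeeds exactly
`N` times; this gives termination and the time bound together. -/
theorem Halts.loop {b : Cond} {N : ℕ} (I : ℕ → State → Prop) (h0 : I 0 s)
    (hb : ∀ k ≤ N, ∀ s, I k s → (b.holds s ↔ k < N))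
    (hP : ∀ k < N, ∀ s, I k s → Halts f ω P s T (I (k + 1))) :
    Halts f ω (.loop b P) s (N * (b.cost + T) + b.cost) (I N) := by
  suffices ∀ d k s, k + d = N → I k s →
      Halts f ω (.loop b P) s (d * (b.cost + T) + b.cost) (I N) from
    this N 0 s (zero_add N) h0
  intro d
  induction d with
  | zero =>
    rintro k s rfl hI
    refine ⟨_, by simp, s, .loopFalse fun h => ?_, hI⟩
    exact (lt_irrefl _) ((hb k le_rfl s hI).1 h)
  | succ d ih =>
    intro k s hk hI
    have hk' : k < N := by omega
    obtain ⟨t₁, ht₁, s₁, e₁, hI₁⟩ := hP k hk' s hI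
    obtain ⟨t₂, ht₂, s₂, e₂, hI₂⟩ := ih (k + 1) s₁ (by omega) hI₁
    refine ⟨_, ?_, s₂, .loopTrue ((hb k hk'.le s hI).2 hk') e₁ e₂, hI₂⟩
    rw [Nat.succ_mul]
    omega

/-- `for i = 0, 1, …` while `b` holds. -/
def forLoop (i : ℕ) (b : Cond) (P : Prog) : Prog :=
  .seq (.setNat i (.const 0)) (.loop b (.seq P (.setNat i (.add (.reg i) (.const 1)))))

@[simp] theorem State.putNat_nat (s : State) (i v j : ℕ) :
    (s.putNat i v).nat j = if j = i then v else s.nat j := by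
  simp [State.putNat, Function.update_apply]

@[simp] theorem State.putNat_real (s : State) (i v : ℕ) : (s.putNat i v).real = s.real := rfl

@[simp] theorem State.putNat_coins (s : State) (i v : ℕ) : (s.putNat i v).coins = s.coins := rfl

@[simp] theorem State.putReal_nat (s : State) (a i : ℕ) (v : ℝ) :
    (s.putReal a i v).nat = s.nat := rfl

@[simp] theorem State.putReal_coins (s : State) (a i : ℕ) (v : ℝ) :
    (s.putReal a i v).coins = s.coins := rfl

@[simp] theorem State.putReal_real (s : State) (a i : ℕ) (v : ℝ) (b : ℕ) :
    (s.putReal a i v).real b = if b = a then Function.update (s.real a) i v else s.real b := by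
  unfold State.putReal
  by_cases h : b = a
  · subst h; simp
  · simp [h]

/-- The allowance of `60` per iteration covers the test, at most `50`, and the increment of the
counter; the extra iteration covers the initialization and the failing last test. -/
theorem Halts.forLoop {i : ℕ} {b : Cond} {N : ℕ} (I : ℕ → State → Prop) (h0 : I 0 (s.putNat i 0))
    (hb : ∀ k ≤ N, ∀ s, I k s → (b.holds s ↔ k < N))
    (hP : ∀ k < N, ∀ s, I k s →
      Halts f ω P s T fun s' => I (k + 1) (s'.putNat i (s'.nat i + 1)))
    (hc : b.cost ≤ 50 := by decide) :
    Halts f ω (OracleRAM.forLoop i b P) s ((N + 1) * (T + 60)) (I N) := by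
  refine Halts.mono (Halts.seq (T' := N * (b.cost + (T + 4)) + b.cost) (Halts.setNat ?_)) ?_
    fun _ h => h
  · exact Halts.loop I h0 hb fun k hk s hI =>
      Halts.seq ((hP k hk s hI).weaken fun s' hs' => Halts.setNat hs')
  · have : N * (b.cost + (T + 4)) ≤ N * (T + 60) := Nat.mul_le_mul_left _ (by omega)
    rw [Nat.succ_mul]
    simp only [NatExpr.cost]
    omega

/-- Only the arrays in `A` and the registers in `N` differ. -/
def Frame (A N : Finset ℕ) (s s' : State) : Prop :=
  (∀ a ∉ A, s'.real a = s.real a) ∧ ∀ i ∉ N, s'.nat i = s.nat i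

theorem Frame.refl (A N : Finset ℕ) (s : State) : Frame A N s s :=
  ⟨fun _ _ => rfl, fun _ _ => rfl⟩

theorem Frame.trans {A N A' N' : Finset ℕ} {s s' s'' : State} (h : Frame A N s s')
    (h' : Frame A' N' s' s'') (hA : A' ⊆ A := by decide) (hN : N' ⊆ N := by decide) :
    Frame A N s s'' :=
  ⟨fun a ha => (h'.1 a fun e => ha (hA e)).trans (h.1 a ha),
    fun i hi => (h'.2 i fun e => hi (hN e)).trans (h.2 i hi)⟩

theorem Frame.putNat {A N : Finset ℕ} {s s' : State} (h : Frame A N s s') {i v : ℕ}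
    (hi : i ∈ N := by decide) : Frame A N s (s'.putNat i v) :=
  ⟨h.1, fun j hj => by
    rw [State.putNat_nat, if_neg (by rintro rfl; exact hj hi)]; exact h.2 j hj⟩

theorem Frame.putReal {A N : Finset ℕ} {s s' : State} (h : Frame A N s s') {a i : ℕ} {v : ℝ}
    (ha : a ∈ A := by decide) : Frame A N s (s'.putReal a i v) :=
  ⟨fun b hb => by
    rw [State.putReal_real, if_neg (by rintro rfl; exact hb ha)]; exact h.1 b hb, h.2⟩

theorem Frame.withCoins {A N : Finset ℕ} {s s' : State} (h : Frame A N s s') (c : ℕ) :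
    Frame A N s { s' with coins := c } := h

theorem Frame.real_eq {A N : Finset ℕ} {s s' : State} (h : Frame A N s s') (a : ℕ)
    (ha : a ∉ A := by decide) : s'.real a = s.real a := h.1 a ha

theorem Frame.nat_eq {A N : Finset ℕ} {s s' : State} (h : Frame A N s s') (i : ℕ)
    (hi : i ∉ N := by decide) : s'.nat i = s.nat i := h.2 i hi

end Rules

/-! ### The program -/

/-- The entry of array `a` at index `0`. -/
abbrev scalar (a : ℕ) : RealExpr := .cell a (.const 0)

/-- The test that register `i` is less than the size of the ground set. -/
abbrev belowSize (i : ℕ) : Cond := .not (.natLE (.reg 0) (.reg i))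

/-- The size of the ground set as a real number. -/
abbrev sizeExpr : RealExpr := .cast (.reg 0)

/-- Natural expressions have no multiplication, so powers of the size are formed as reals. Array
use: `2` the point, `3` marks of a set, `4` gains, `5` the direction, `6` the decay factor, `7` and
`8` a random number and its latest bit, `9` and `10` oracle values, `11` and `12` the low and high
sums. -/
abbrev sizePow3 : RealExpr := .mul (.mul sizeExpr sizeExpr) sizeExpr

abbrev sizePow4 : RealExpr := .mul sizePow3 sizeExpr

/-- A random dyadic number. -/
def dyadicProg : Prog :=
  .seq (.setReal 7 (.const 0) (.const 0))
    (forLoop 3 (belowSize 3) (.seq (.flip 8 (.const 0))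
      (.setReal 7 (.const 0) (.div (.add (scalar 7) (scalar 8)) (.const 2)))))

/-- A random set, marked in array `3`. -/
def sampleProg : Prog :=
  forLoop 2 (belowSize 2) (.seq dyadicProg
    (.ite (.realLE (.cell 2 (.reg 2)) (scalar 7))
      (.setReal 3 (.reg 2) (.const 0)) (.setReal 3 (.reg 2) (.const 1))))

/-- Running it a second time restores the marked set, so one array serves all elements. -/
abbrev toggleProg : Prog := .setReal 3 (.reg 2) (.sub (.const 1) (.cell 3 (.reg 2)))

/-- Add the gains of toggling the elements to array `4`. -/
def gainsProg : Prog :=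
  forLoop 2 (belowSize 2) (.seq toggleProg (.seq (.query 3 10 (.const 0)) (.seq toggleProg
    (.setReal 4 (.reg 2) (.add (.cell 4 (.reg 2)) (.sub (scalar 10) (scalar 9)))))))

/-- Set array `4` to zero. -/
def clearProg : Prog := forLoop 2 (belowSize 2) (.setReal 4 (.reg 2) (.const 0))

/-- Estimate the gains from `n ^ 6` samples. -/
def estimateProg : Prog :=
  .seq clearProg (forLoop 1 (.not (.realLE (.mul sizePow3 sizePow3) (.cast (.reg 1))))
    (.seq sampleProg (.seq (.query 3 9 (.const 0)) gainsProg)))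

/-- The test that the element in register `i` is eligible. -/
abbrev eligibleCond (i : ℕ) : Cond :=
  .and (.not (.realLE (.cell 4 (.reg i)) (.const 0))) (.realLE (.cell 1 (.reg i)) (scalar 0))

/-- The product of the weight of the element in register `i` and the cost of that in `j`. -/
abbrev crossExpr (i j : ℕ) : RealExpr := .mul (.cell 4 (.reg i)) (.cell 1 (.reg j))

/-- The low sum and the high sum of the element in register `2`. -/
def sumsProg : Prog :=
  .seq (.setReal 11 (.const 0) (.const 0)) (.seq (.setReal 12 (.const 0) (.const 0))
    (forLoop 3 (belowSize 3)
      (.seq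
        (.ite (.and (eligibleCond 3) (.not (.realLE (crossExpr 3 2) (crossExpr 2 3))))
          (.setReal 11 (.const 0) (.add (scalar 11) (.cell 1 (.reg 3)))) .skip)
        (.ite (.and (eligibleCond 3) (.realLE (crossExpr 2 3) (crossExpr 3 2)))
          (.setReal 12 (.const 0) (.add (scalar 12) (.cell 1 (.reg 3)))) .skip))))

/-- The fractional knapsack solution for the weights in array `4`, stored in array `5`. -/
def knapsackProg : Prog :=
  forLoop 2 (belowSize 2)
    (.ite (eligibleCond 2)
      (.seq sumsProg
        (.ite (.realLE (scalar 12) (scalar 0)) (.setReal 5 (.reg 2) (.const 1))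
          (.ite (.realLE (scalar 11) (scalar 0))
            (.setReal 5 (.reg 2)
              (.div (.sub (scalar 0) (scalar 11)) (.sub (scalar 12) (scalar 11))))
            (.setReal 5 (.reg 2) (.const 0)))))
      (.setReal 5 (.reg 2) (.const 0)))

/-- The step length `1 / (2 n ^ 4)`. -/
abbrev stepExpr : RealExpr := .div (.const 1) (.mul (.const 2) sizePow4)

/-- Move the point in array `2` in the direction in array `5`. -/
def moveProg : Prog :=
  forLoop 2 (belowSize 2)
    (.setReal 2 (.reg 2) (.add (.cell 2 (.reg 2))
      (.mul (.mul stepExpr (.sub (.const 1) (.mul (.const 2) (.cell 2 (.reg 2)))))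
        (.cell 5 (.reg 2)))))

/-- The next value of the decaying factor in array `6`. -/
abbrev decayExpr : RealExpr := .mul (scalar 6) (.sub (.const 1) (.mul (.const 2) stepExpr))

/-- The algorithm: measured continuous greedy steps while the factor stays at least `2 ε`. -/
def greedyProg : Prog :=
  .seq (.setReal 6 (.const 0) (.const 1))
    (.loop (.realLE (.mul (.const 2) (.cell 0 (.const 1))) decayExpr)
      (.seq estimateProg (.seq knapsackProg (.seq moveProg
        (.setReal 6 (.const 0) decayExpr)))))

/-! ### Correctness of the program -/

section Correctness

variable {n : ℕ} {f : Finset (Fin n) → ℝ} {ω : ℕ → Bool}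

theorem belowSize_holds {s : State} {i k : ℕ} (h0 : s.nat 0 = n) (hi : s.nat i = k) :
    (belowSize i).holds s ↔ k < n := by
  simp [Cond.holds, NatExpr.eval, h0, hi]

theorem halts_dyadicProg {s : State} (h0 : s.nat 0 = n) :
    Halts f ω dyadicProg s (80 * (n + 1)) fun s' => Frame {7, 8} {3} s s' ∧
      s'.coins = s.coins + n ∧ s'.real 7 0 = dyadic (shiftTape s.coins ω) n := by
  have key := Halts.forLoop (f := f) (ω := ω) (i := 3) (b := belowSize 3) (N := n) (T := 15)
    (P := .seq (.flip 8 (.const 0))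
      (.setReal 7 (.const 0) (.div (.add (scalar 7) (scalar 8)) (.const 2))))
    (s := s.putReal 7 0 ((0 : ℚ) : ℝ))
    (fun k s' => Frame {7, 8} {3} s s' ∧ s'.nat 3 = k ∧ s'.coins = s.coins + k ∧
      s'.real 7 0 = dyadic (shiftTape s.coins ω) k)
    ⟨((Frame.refl _ _ s).putReal).putNat, by simp [dyadic]⟩
    (fun k _ s' hs' => belowSize_holds ((hs'.1.nat_eq 0).trans h0) hs'.2.1)
    (fun k _ s' hs' => by
      obtain ⟨hF, h3, hc, hv⟩ := hs'
      refine Halts.mono (Halts.seq (Halts.flip (Halts.setReal ?_))) (by decide) fun _ h => h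
      refine ⟨((hF.putReal).withCoins _).putReal.putNat, ?_⟩
      simp [NatExpr.eval, RealExpr.eval, h3, hc, hv, dyadic, shiftTape, add_assoc]
      rfl)
  exact (Halts.seq (Halts.setReal key)).mono (by simp only [NatExpr.cost, RealExpr.cost]; omega)
    fun s' hs' => ⟨hs'.1, hs'.2.2⟩

theorem halts_sampleProg {s : State} (h0 : s.nat 0 = n) :
    Halts f ω sampleProg s (160 * (n + 1) ^ 2) fun s' => Frame {3, 7, 8} {2, 3} s s' ∧
      s'.coins = s.coins + n * n ∧ ∀ u : Fin n, s'.real 3 u =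
        if u ∈ sampleSet (s.output n) n (shiftTape s.coins ω) then 1 else 0 := by
  classical
  have key := Halts.forLoop (f := f) (ω := ω) (i := 2) (b := belowSize 2) (N := n)
    (T := 80 * (n + 1) + 20)
    (P := .seq dyadicProg
      (.ite (.realLE (.cell 2 (.reg 2)) (scalar 7))
        (.setReal 3 (.reg 2) (.const 0)) (.setReal 3 (.reg 2) (.const 1))))
    (s := s)
    (fun k s' => Frame {3, 7, 8} {2, 3} s s' ∧ s'.nat 2 = k ∧ s'.coins = s.coins + k * n ∧
      ∀ u : Fin n, (u : ℕ) < k → s'.real 3 u =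
        if dyadic (shiftTape (u * n) (shiftTape s.coins ω)) n < s.output n u then 1 else 0)
    ⟨(Frame.refl _ _ s).putNat, by simp⟩
    (fun k _ s' hs' => belowSize_holds ((hs'.1.nat_eq 0).trans h0) hs'.2.1)
    (fun k hk s' hs' => by
      obtain ⟨hF, h2, hc, hv⟩ := hs'
      refine Halts.bind (halts_dyadicProg ((hF.nat_eq 0).trans h0)) 20 le_rfl fun s₁ hs₁ => ?_
      obtain ⟨hF₁, hc₁, hd⟩ := hs₁
      have hF₂ : Frame {3, 7, 8} {2, 3} s s₁ := hF.trans hF₁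
      have h2' : s₁.nat 2 = k := (hF₁.nat_eq 2).trans h2
      have h3 : s₁.real 3 = s'.real 3 := hF₁.real_eq 3
      have hx : s₁.real 2 = s.real 2 := hF₂.real_eq 2
      -- Both branches end by writing a mark at index `k`; it remains to check that each writes the
      -- right one.
      have hfin : ∀ v : ℝ, (v = if dyadic (shiftTape (k * n) (shiftTape s.coins ω)) n <
          s.real 2 k then 1 else 0) →
          (fun s' => Frame {3, 7, 8} {2, 3} s s' ∧ s'.nat 2 = k + 1 ∧
            s'.coins = s.coins + (k + 1) * n ∧ ∀ u : Fin n, (u : ℕ) < k + 1 → s'.real 3 u =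
            if dyadic (shiftTape (u * n) (shiftTape s.coins ω)) n < s.output n u then 1 else 0)
          ((s₁.putReal 3 k v).putNat 2 ((s₁.putReal 3 k v).nat 2 + 1)) := by
        intro v hvv
        refine ⟨hF₂.putReal.putNat, by simp [h2'], ?_, fun u hu => ?_⟩
        · simp only [State.putNat_coins, State.putReal_coins, hc₁, hc]; ring
        · simp only [State.putNat_real, State.putReal_real, if_true, Function.update_apply]
          by_cases huk : (u : ℕ) = k
          · rw [if_pos huk, hvv]; simp only [huk, State.output]
          · rw [if_neg huk, h3]; exact hv u (by omega)
      rw [shiftTape_shiftTape] at hfin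
      rw [hc] at hd
      refine Halts.mono (Halts.ite (T := 10) (T' := 10) (fun hle => ?_) (fun hlt => ?_))
        (by decide) fun _ h => h
      · refine Halts.mono (Halts.setReal ?_) (by decide) fun _ h => h
        simp only [NatExpr.eval, h2', RealExpr.eval, Rat.cast_zero]
        refine hfin 0 ?_
        simp only [Cond.holds, RealExpr.eval, NatExpr.eval, h2', hx, hd] at hle
        rw [if_neg (not_lt.2 hle)]
      · refine Halts.mono (Halts.setReal ?_) (by decide) fun _ h => h
        simp only [NatExpr.eval, h2', RealExpr.eval, Rat.cast_one]
        refine hfin 1 ?_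
        simp only [Cond.holds, RealExpr.eval, NatExpr.eval, h2', hx, hd] at hlt
        rw [if_pos (not_le.1 hlt)])
  refine key.mono ?_ fun s' hs' => ⟨hs'.1, hs'.2.2.1, fun u => ?_⟩
  · nlinarith
  · rw [hs'.2.2.2 u u.2]
    simp [sampleSet, sampleBelow]

theorem markedSet_eq {s : State} {a : ℕ} {S : Finset (Fin n)}
    (h : ∀ u : Fin n, s.real a u = if u ∈ S then 1 else 0) : s.markedSet n a = S := by
  classical
  ext u
  simp only [State.markedSet, Finset.mem_filter, Finset.mem_univ, true_and, h]
  split_ifs with hu <;> simp [hu]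

theorem halts_gainsProg {s : State} {S : Finset (Fin n)} (h0 : s.nat 0 = n)
    (hS : ∀ u : Fin n, s.real 3 u = if u ∈ S then 1 else 0) (h9 : s.real 9 0 = f S) :
    Halts f ω gainsProg s (100 * (n + 1)) fun s' => Frame {3, 4, 10} {2} s s' ∧
      s'.coins = s.coins ∧ ∀ u : Fin n, s'.real 4 u = s.real 4 u + toggleGain f u S := by
  have key := Halts.forLoop (f := f) (ω := ω) (i := 2) (b := belowSize 2) (N := n) (T := 40)
    (P := .seq toggleProg (.seq (.query 3 10 (.const 0)) (.seq toggleProg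
      (.setReal 4 (.reg 2) (.add (.cell 4 (.reg 2)) (.sub (scalar 10) (scalar 9)))))))
    (s := s)
    (fun k s' => Frame {3, 4, 10} {2} s s' ∧ s'.nat 2 = k ∧ s'.coins = s.coins ∧
      (∀ u : Fin n, s'.real 3 u = if u ∈ S then 1 else 0) ∧
      ∀ u : Fin n, s'.real 4 u = s.real 4 u + if (u : ℕ) < k then toggleGain f u S else 0)
    ⟨(Frame.refl _ _ s).putNat, by simp [hS]⟩
    (fun k _ s' hs' => belowSize_holds ((hs'.1.nat_eq 0).trans h0) hs'.2.1)
    (fun k hk s' hs' => by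
      obtain ⟨hF, h2, hc, hv, hw⟩ := hs'
      set i : Fin n := ⟨k, hk⟩ with hi
      refine Halts.mono (Halts.seq (Halts.setReal (Halts.seq (Halts.query (Halts.seq
        (Halts.setReal (Halts.setReal ?_))))))) (by decide) fun _ h => h
      simp only [NatExpr.eval, RealExpr.eval, State.putReal_nat, h2]
      -- The query between the two toggles sees the toggled set.
      have hmark : (s'.putReal 3 k (((1 : ℚ) : ℝ) - s'.real 3 k)).markedSet n 3 = toggle i S := by
        refine markedSet_eq fun u => ?_
        simp only [State.putReal_real, if_true, Function.update_apply]
        by_cases huk : (u : ℕ) = k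
        · have hui : u = i := Fin.ext huk
          rw [if_pos huk, ← huk, hv u, hui]
          unfold toggle
          by_cases hm : i ∈ S <;> simp [hm]
        · have hui : u ≠ i := fun e => huk (by rw [e])
          rw [if_neg huk, hv u]
          unfold toggle
          by_cases hm : i ∈ S <;> simp [hm, hui]
      refine ⟨hF.putReal.putReal.putReal.putReal.putNat, by simp, by simp [hc],
        fun u => ?_, fun u => ?_⟩
      · by_cases huk : (u : ℕ) = k
        · simp [← huk, hv u]
        · simp [huk, hv u]
      · rw [hmark]
        have h9' : s'.real 9 0 = f S := by rw [hF.real_eq 9, h9]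
        by_cases huk : (u : ℕ) = k
        · have hui : i = u := Fin.ext huk.symm
          have hwu := hw u
          rw [huk] at hwu ⊢
          simp [hwu, h9', hui, toggleGain]
        · have hlt : (u : ℕ) < k + 1 ↔ (u : ℕ) < k := by omega
          simp only [State.putNat_real, State.putReal_real, if_true, Function.update_apply, huk,
            if_false, hlt]
          simpa using hw u)
  refine key.mono (by omega) fun s' hs' => ⟨hs'.1, hs'.2.2.1, fun u => ?_⟩
  rw [hs'.2.2.2.2 u, if_pos u.2]

theorem halts_clearProg {s : State} (h0 : s.nat 0 = n) :
    Halts f ω clearProg s (70 * (n + 1)) fun s' => Frame {4} {2} s s' ∧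
      s'.coins = s.coins ∧ ∀ u : Fin n, s'.real 4 u = 0 := by
  have key := Halts.forLoop (f := f) (ω := ω) (i := 2) (b := belowSize 2) (N := n) (T := 10)
    (P := .setReal 4 (.reg 2) (.const 0)) (s := s)
    (fun k s' => Frame {4} {2} s s' ∧ s'.nat 2 = k ∧ s'.coins = s.coins ∧
      ∀ u : Fin n, (u : ℕ) < k → s'.real 4 u = 0)
    ⟨(Frame.refl _ _ s).putNat, by simp⟩
    (fun k _ s' hs' => belowSize_holds ((hs'.1.nat_eq 0).trans h0) hs'.2.1)
    (fun k _ s' hs' => by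
      obtain ⟨hF, h2, hc, hv⟩ := hs'
      refine Halts.mono (Halts.setReal ?_) (by decide) fun _ h => h
      refine ⟨hF.putReal.putNat, by simp [h2], by simp [hc], fun u hu => ?_⟩
      by_cases huk : (u : ℕ) = k
      · simp [huk, NatExpr.eval, RealExpr.eval, h2]
      · simp [huk, NatExpr.eval, h2, hv u (by omega)])
  exact key.mono (by omega) fun s' hs' => ⟨hs'.1, hs'.2.2.1, fun u => hs'.2.2.2 u u.2⟩

theorem halts_estimateProg {s : State} (h0 : s.nat 0 = n) :
    Halts f ω estimateProg s (900 * (n + 1) ^ 8) fun s' =>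
      Frame {3, 4, 7, 8, 9, 10} {1, 2, 3} s s' ∧
      s'.coins = s.coins + (n ^ 3) ^ 2 * (n * n) ∧ ∀ u : Fin n, s'.real 4 u =
        sampledGain f (s.output n) n ((n ^ 3) ^ 2) (shiftTape s.coins ω) u := by
  refine Halts.bind (halts_clearProg h0) (((n ^ 3) ^ 2 + 1) * (320 * (n + 1) ^ 2 + 60)) ?_
    fun s₁ hs₁ => ?_
  · have h1 : (n ^ 3) ^ 2 ≤ (n + 1) ^ 6 := by
      rw [← pow_mul]; exact Nat.pow_le_pow_left (Nat.le_succ n) _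
    have h2 : 1 ≤ (n + 1) ^ 6 := Nat.one_le_pow _ _ (Nat.succ_pos n)
    have h3 : 1 ≤ (n + 1) ^ 2 := Nat.one_le_pow _ _ (Nat.succ_pos n)
    have h4 : n + 1 ≤ (n + 1) ^ 8 := Nat.le_self_pow (by norm_num) _
    have h5 : ((n ^ 3) ^ 2 + 1) * (320 * (n + 1) ^ 2 + 60) ≤
        (2 * (n + 1) ^ 6) * (380 * (n + 1) ^ 2) := Nat.mul_le_mul (by omega) (by omega)
    have h6 : (2 * (n + 1) ^ 6) * (380 * (n + 1) ^ 2) = 760 * (n + 1) ^ 8 := by ring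
    omega
  obtain ⟨hF₁, hc₁, hw₁⟩ := hs₁
  have key := Halts.forLoop (f := f) (ω := ω) (i := 1)
    (b := .not (.realLE (.mul sizePow3 sizePow3) (.cast (.reg 1)))) (N := (n ^ 3) ^ 2)
    (T := 320 * (n + 1) ^ 2)
    (P := .seq sampleProg (.seq (.query 3 9 (.const 0)) gainsProg)) (s := s₁)
    (fun k s' => Frame {3, 4, 7, 8, 9, 10} {1, 2, 3} s s' ∧ s'.nat 1 = k ∧
      s'.coins = s.coins + k * (n * n) ∧
      ∀ u : Fin n, s'.real 4 u = sampledGain f (s.output n) n k (shiftTape s.coins ω) u)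
    ⟨((Frame.refl _ _ s).trans hF₁).putNat, by simp, by simp [hc₁],
      fun u => by simp [hw₁ u, sampledGain]⟩
    (fun k _ s' hs' => by
      have hn : s'.nat 0 = n := (hs'.1.nat_eq 0).trans h0
      simp only [Cond.holds, RealExpr.eval, NatExpr.eval, hn, hs'.2.1, not_le]
      -- The program compares the counter with `n ^ 6` as reals.
      rw [← Nat.cast_lt (α := ℝ)]
      push_cast
      ring_nf)
    (fun k _ s' hs' => by
      obtain ⟨hF, h1, hc, hw⟩ := hs'
      have hn : s'.nat 0 = n := (hF.nat_eq 0).trans h0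
      refine Halts.bind (halts_sampleProg hn) (2 + 100 * (n + 1)) (by nlinarith) fun s₂ hs₂ => ?_
      obtain ⟨hF₂, hc₂, hm⟩ := hs₂
      set S := sampleSet (s'.output n) n (shiftTape s'.coins ω) with hSdef
      have hn₂ : s₂.nat 0 = n := (hF₂.nat_eq 0).trans hn
      refine Halts.seq (Halts.query ?_)
      refine (halts_gainsProg (S := S) (by simpa using hn₂) (fun u => by simp [hm u])
        (by simp [NatExpr.eval, markedSet_eq hm])).weaken fun s₃ hs₃ => ?_
      obtain ⟨hF₃, hc₃, hw₃⟩ := hs₃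
      have hF' : Frame {3, 4, 7, 8, 9, 10} {1, 2, 3} s s₃ := (hF.trans hF₂).putReal.trans hF₃
      have h1' : s₃.nat 1 = k := by
        rw [hF₃.nat_eq 1, State.putReal_nat, hF₂.nat_eq 1, h1]
      refine ⟨hF'.putNat, by simp [h1'], ?_, fun u => ?_⟩
      · simp only [State.putNat_coins, hc₃, State.putReal_coins, hc₂, hc]; ring
      · have h4 : s₂.real 4 = s'.real 4 := hF₂.real_eq 4
        have hx : s'.output n = s.output n := by
          ext v; simp only [State.output, hF.real_eq 2]
        simp only [State.putNat_real, hw₃ u]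
        simp only [State.putReal_real, Nat.reduceEqDiff, if_false, h4, hw u]
        rw [hSdef, hx, hc]
        simp only [sampledGain, Finset.sum_range_succ, shiftTape_shiftTape])
  exact key.weaken fun s' hs' => ⟨hs'.1, hs'.2.2⟩

theorem sum_below_succ (t : Fin n → ℝ) {k : ℕ} (hk : k < n) :
    ∑ v : Fin n, (if (v : ℕ) < k + 1 then t v else 0) =
      ∑ v : Fin n, (if (v : ℕ) < k then t v else 0) + t ⟨k, hk⟩ := by
  have : ∀ v : Fin n, (if (v : ℕ) < k + 1 then t v else 0) =
      (if (v : ℕ) < k then t v else 0) + if v = ⟨k, hk⟩ then t v else 0 := fun v => by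
    by_cases h : (v : ℕ) = k
    · have hv : v = ⟨k, hk⟩ := Fin.ext h
      simp [hv]
    · have hv : v ≠ ⟨k, hk⟩ := fun e => h (by rw [e])
      have hlt : (v : ℕ) < k + 1 ↔ (v : ℕ) < k := by omega
      simp only [hlt, hv, if_false, add_zero]
  simp only [this, Finset.sum_add_distrib]
  simp

theorem eligibleCond_holds {s : State} {p : Fin n → ℝ} {B : ℝ} (hB : s.real 0 0 = B)
    (hp : ∀ u : Fin n, s.real 1 u = p u) {i : ℕ} (u : Fin n) (hi : s.nat i = u) :
    (eligibleCond i).holds s ↔ Eligible p B (fun u => s.real 4 u) u := by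
  simp [Cond.holds, RealExpr.eval, NatExpr.eval, Eligible, hi, hp u, hB]

theorem halts_sumsProg {s : State} {p : Fin n → ℝ} {B : ℝ} (h0 : s.nat 0 = n)
    (hB : s.real 0 0 = B) (hp : ∀ u : Fin n, s.real 1 u = p u) (u : Fin n) (hu : s.nat 2 = u) :
    Halts f ω sumsProg s (200 * (n + 1)) fun s' => Frame {11, 12} {3} s s' ∧
      s'.coins = s.coins ∧ s'.real 11 0 = lowSum p B (fun u => s.real 4 u) u ∧
      s'.real 12 0 = highSum p B (fun u => s.real 4 u) u := by
  classical
  set w : Fin n → ℝ := fun u => s.real 4 u with hw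
  set tl : Fin n → ℝ := fun v =>
    if Eligible p B w v ∧ ¬ w v * p u ≤ w u * p v then p v else 0 with htl
  set th : Fin n → ℝ := fun v =>
    if Eligible p B w v ∧ w u * p v ≤ w v * p u then p v else 0 with hth
  have key := Halts.forLoop (f := f) (ω := ω) (i := 3) (b := belowSize 3) (N := n) (T := 100)
    (P := .seq
        (.ite (.and (eligibleCond 3) (.not (.realLE (crossExpr 3 2) (crossExpr 2 3))))
          (.setReal 11 (.const 0) (.add (scalar 11) (.cell 1 (.reg 3)))) .skip)
        (.ite (.and (eligibleCond 3) (.realLE (crossExpr 2 3) (crossExpr 3 2)))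
          (.setReal 12 (.const 0) (.add (scalar 12) (.cell 1 (.reg 3)))) .skip))
    (s := (s.putReal 11 0 ((0 : ℚ) : ℝ)).putReal 12 0 ((0 : ℚ) : ℝ))
    (fun k s' => Frame {11, 12} {3} s s' ∧ s'.nat 3 = k ∧ s'.coins = s.coins ∧
      s'.real 11 0 = ∑ v : Fin n, (if (v : ℕ) < k then tl v else 0) ∧
      s'.real 12 0 = ∑ v : Fin n, (if (v : ℕ) < k then th v else 0))
    ⟨((Frame.refl _ _ s).putReal).putReal.putNat, by simp⟩
    (fun k _ s' hs' => belowSize_holds ((hs'.1.nat_eq 0).trans h0) hs'.2.1)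
    (fun k hk s' hs' => by
      obtain ⟨hF, h3, hc, hl, hh⟩ := hs'
      -- Stated for every state in the frame, as the second conditional runs after the first may
      -- have changed its accumulator.
      have helig : ∀ s₁ : State, Frame {11, 12} {3} s s₁ → s₁.nat 3 = k →
          ((eligibleCond 3).holds s₁ ↔ Eligible p B w ⟨k, hk⟩) ∧
          ((Cond.realLE (crossExpr 3 2) (crossExpr 2 3)).holds s₁ ↔
            w ⟨k, hk⟩ * p u ≤ w u * p ⟨k, hk⟩) ∧
          ((Cond.realLE (crossExpr 2 3) (crossExpr 3 2)).holds s₁ ↔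
            w u * p ⟨k, hk⟩ ≤ w ⟨k, hk⟩ * p u) ∧ s₁.real 1 k = p ⟨k, hk⟩ := by
        intro s₁ hF₁ hk₁
        have e1 : s₁.real 1 = s.real 1 := hF₁.real_eq 1
        have e4 : s₁.real 4 = s.real 4 := hF₁.real_eq 4
        have e0 : s₁.real 0 = s.real 0 := hF₁.real_eq 0
        have e2 : s₁.nat 2 = u := (hF₁.nat_eq 2).trans hu
        have hpk : s.real 1 k = p ⟨k, hk⟩ := hp ⟨k, hk⟩
        have := eligibleCond_holds (s := s₁) (p := p) (B := B) (by rw [e0, hB])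
          (fun v => by rw [e1, hp]) (i := 3) ⟨k, hk⟩ hk₁
        rw [e4] at this
        refine ⟨this, ?_, ?_, by rw [e1, hpk]⟩ <;>
        simp [Cond.holds, RealExpr.eval, NatExpr.eval, e1, e2, e4, hk₁, hpk, hp u, hw]
      refine Halts.bind (R₁ := fun s₁ => Frame {11, 12} {3} s s₁ ∧ s₁.nat 3 = k ∧
        s₁.coins = s.coins ∧
        s₁.real 11 0 = ∑ v : Fin n, (if (v : ℕ) < k + 1 then tl v else 0) ∧
        s₁.real 12 0 = ∑ v : Fin n, (if (v : ℕ) < k then th v else 0)) (T := 50) ?_ 50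
        (by norm_num) fun s₁ hs₁ => ?_
      · obtain ⟨g1, g2, -, g4⟩ := helig s' hF h3
        refine Halts.mono (Halts.ite (fun hb => Halts.setReal ?_) (fun hb => Halts.skip ?_))
          (by decide) fun _ h => h
        · have hb' : Eligible p B w ⟨k, hk⟩ ∧ ¬ w ⟨k, hk⟩ * p u ≤ w u * p ⟨k, hk⟩ :=
            ⟨g1.1 hb.1, fun e => hb.2 (g2.2 e)⟩
          refine ⟨hF.putReal, by simp [h3], by simp [hc], ?_, by simp [hh]⟩
          rw [sum_below_succ tl hk, htl]
          simp only [NatExpr.eval, RealExpr.eval, State.putReal_real, if_true,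
            Function.update_self, hl, h3, g4, if_pos hb', htl]
        · have hb' : ¬ (Eligible p B w ⟨k, hk⟩ ∧ ¬ w ⟨k, hk⟩ * p u ≤ w u * p ⟨k, hk⟩) :=
            fun e => hb ⟨g1.2 e.1, fun e' => e.2 (g2.1 e')⟩
          refine ⟨hF, h3, hc, ?_, hh⟩
          rw [sum_below_succ tl hk, hl]
          simp only [htl, if_neg hb', add_zero]
      · obtain ⟨hF₁, h3₁, hc₁, hl₁, hh₁⟩ := hs₁
        obtain ⟨g1, -, g3, g4⟩ := helig s₁ hF₁ h3₁
        refine Halts.mono (Halts.ite (fun hb => Halts.setReal ?_) (fun hb => Halts.skip ?_))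
          (by decide) fun _ h => h
        · have hb' : Eligible p B w ⟨k, hk⟩ ∧ w u * p ⟨k, hk⟩ ≤ w ⟨k, hk⟩ * p u :=
            ⟨g1.1 hb.1, g3.1 hb.2⟩
          refine ⟨hF₁.putReal.putNat, by simp [h3₁], by simp [hc₁], by simp [hl₁], ?_⟩
          rw [sum_below_succ th hk]
          simp only [NatExpr.eval, RealExpr.eval, State.putReal_real, State.putNat_real, if_true,
            Function.update_self, hh₁, h3₁, g4, if_pos hb', hth]
        · have hb' : ¬ (Eligible p B w ⟨k, hk⟩ ∧ w u * p ⟨k, hk⟩ ≤ w ⟨k, hk⟩ * p u) :=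
            fun e => hb ⟨g1.2 e.1, g3.2 e.2⟩
          refine ⟨hF₁.putNat, by simp [h3₁], by simp [hc₁], by simp [hl₁], ?_⟩
          rw [sum_below_succ th hk, State.putNat_real, hh₁]
          simp only [hth, if_neg hb', add_zero])
  refine (Halts.seq (Halts.setReal (Halts.seq (Halts.setReal key)))).mono
    (by simp only [NatExpr.cost, RealExpr.cost]; omega)
    fun s' hs' => ⟨hs'.1, hs'.2.2.1, ?_, ?_⟩
  · rw [hs'.2.2.2.1]
    exact Finset.sum_congr rfl fun v _ => by rw [if_pos v.2]
  · rw [hs'.2.2.2.2]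
    exact Finset.sum_congr rfl fun v _ => by rw [if_pos v.2]

theorem halts_knapsackProg {s : State} {p : Fin n → ℝ} {B : ℝ} (h0 : s.nat 0 = n)
    (hB : s.real 0 0 = B) (hp : ∀ u : Fin n, s.real 1 u = p u) :
    Halts f ω knapsackProg s (400 * (n + 1) ^ 2) fun s' => Frame {5, 11, 12} {2, 3} s s' ∧
      s'.coins = s.coins ∧
      ∀ u : Fin n, s'.real 5 u = fracKnapsack p B (fun u => s.real 4 u) u := by
  classical
  set w : Fin n → ℝ := fun u => s.real 4 u with hw
  have key := Halts.forLoop (f := f) (ω := ω) (i := 2) (b := belowSize 2) (N := n)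
    (T := 200 * (n + 1) + 80)
    (P := .ite (eligibleCond 2)
      (.seq sumsProg
        (.ite (.realLE (scalar 12) (scalar 0)) (.setReal 5 (.reg 2) (.const 1))
          (.ite (.realLE (scalar 11) (scalar 0))
            (.setReal 5 (.reg 2)
              (.div (.sub (scalar 0) (scalar 11)) (.sub (scalar 12) (scalar 11))))
            (.setReal 5 (.reg 2) (.const 0)))))
      (.setReal 5 (.reg 2) (.const 0))) (s := s)
    (fun k s' => Frame {5, 11, 12} {2, 3} s s' ∧ s'.nat 2 = k ∧ s'.coins = s.coins ∧
      ∀ u : Fin n, (u : ℕ) < k → s'.real 5 u = fracKnapsack p B w u)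
    ⟨(Frame.refl _ _ s).putNat, by simp⟩
    (fun k _ s' hs' => belowSize_holds ((hs'.1.nat_eq 0).trans h0) hs'.2.1)
    (fun k hk s' hs' => by
      obtain ⟨hF, h2, hc, hv⟩ := hs'
      set i : Fin n := ⟨k, hk⟩ with hi
      have hn : s'.nat 0 = n := (hF.nat_eq 0).trans h0
      have hB' : s'.real 0 0 = B := by rw [hF.real_eq 0, hB]
      have hp' : ∀ u : Fin n, s'.real 1 u = p u := fun u => by rw [hF.real_eq 1, hp]
      have h4 : s'.real 4 = s.real 4 := hF.real_eq 4
      have helig := eligibleCond_holds hB' hp' (i := 2) i h2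
      rw [h4] at helig
      -- All four branches write one value at index `k`; only that value differs.
      have hfin : ∀ (s₁ : State) (v : ℝ), Frame {5, 11, 12} {2, 3} s s₁ → s₁.nat 2 = k →
          s₁.coins = s.coins → s₁.real 5 = s'.real 5 → v = fracKnapsack p B w i →
          (fun s' => Frame {5, 11, 12} {2, 3} s s' ∧ s'.nat 2 = k + 1 ∧ s'.coins = s.coins ∧
            ∀ u : Fin n, (u : ℕ) < k + 1 → s'.real 5 u = fracKnapsack p B w u)
          ((s₁.putReal 5 k v).putNat 2 ((s₁.putReal 5 k v).nat 2 + 1)) := by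
        intro s₁ v hF₁ h2₁ hc₁ h5 hvv
        refine ⟨hF₁.putReal.putNat, by simp [h2₁], by simp [hc₁], fun u hu => ?_⟩
        simp only [State.putNat_real, State.putReal_real, if_true, Function.update_apply]
        by_cases huk : (u : ℕ) = k
        · have hui : u = i := Fin.ext huk
          rw [if_pos huk, hvv, hui]
        · rw [if_neg huk, h5]; exact hv u (by omega)
      refine Halts.mono (Halts.ite (T := 200 * (n + 1) + 50) (T' := 10) (fun hb => ?_)
        (fun hb => ?_)) ?_ fun _ h => h
      · have hE := helig.1 hb
        refine Halts.bind (halts_sumsProg hn hB' hp' i h2) 50 le_rfl fun s₁ hs₁ => ?_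
        obtain ⟨hF₁, hc₁, hl, hh⟩ := hs₁
        rw [h4] at hl hh
        have hF₂ : Frame {5, 11, 12} {2, 3} s s₁ := hF.trans hF₁
        have h2₁ : s₁.nat 2 = k := (hF₁.nat_eq 2).trans h2
        have hB₁ : s₁.real 0 0 = B := by rw [hF₁.real_eq 0, hB']
        have hfin₁ := fun v => hfin s₁ v hF₂ h2₁ (hc₁.trans hc) (hF₁.real_eq 5)
        have hz : fracKnapsack p B w i = if highSum p B w i ≤ B then 1
          else if lowSum p B w i ≤ B then
            (B - lowSum p B w i) / (highSum p B w i - lowSum p B w i) else 0 := by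
          rw [fracKnapsack, if_pos hE]
        refine Halts.mono (Halts.ite (T := 10) (T' := 35) (fun hb₁ => ?_) (fun hb₁ => ?_))
          (by decide) fun _ h => h
        · simp only [Cond.holds, RealExpr.eval, NatExpr.eval, hh, hB₁] at hb₁
          refine Halts.mono (Halts.setReal ?_) (by decide) fun _ h => h
          simp only [NatExpr.eval, RealExpr.eval, h2₁]
          refine hfin₁ _ ?_
          rw [hz, if_pos hb₁, Rat.cast_one]
        · simp only [Cond.holds, RealExpr.eval, NatExpr.eval, hh, hB₁] at hb₁
          refine Halts.mono (Halts.ite (T := 20) (T' := 10) (fun hb₂ => ?_) (fun hb₂ => ?_))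
            (by decide) fun _ h => h
          · simp only [Cond.holds, RealExpr.eval, NatExpr.eval, hl, hB₁] at hb₂
            refine Halts.mono (Halts.setReal ?_) (by decide) fun _ h => h
            simp only [NatExpr.eval, RealExpr.eval, h2₁]
            refine hfin₁ _ ?_
            rw [hz, if_neg hb₁, if_pos hb₂, hl, hh, hB₁]
          · simp only [Cond.holds, RealExpr.eval, NatExpr.eval, hl, hB₁] at hb₂
            refine Halts.mono (Halts.setReal ?_) (by decide) fun _ h => h
            simp only [NatExpr.eval, RealExpr.eval, h2₁]
            refine hfin₁ _ ?_
            rw [hz, if_neg hb₁, if_neg hb₂, Rat.cast_zero]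
      · refine Halts.mono (Halts.setReal ?_) (by decide) fun _ h => h
        simp only [NatExpr.eval, RealExpr.eval, h2]
        refine hfin s' _ hF h2 hc rfl ?_
        rw [fracKnapsack, if_neg fun e => hb (helig.2 e), Rat.cast_zero]
      · simp only [Cond.cost, RealExpr.cost, NatExpr.cost]; omega)
  refine key.mono ?_ fun s' hs' => ⟨hs'.1, hs'.2.2.1, fun u => hs'.2.2.2 u u.2⟩
  refine (Nat.mul_le_mul_left (n + 1) (by omega : _ ≤ 400 * (n + 1))).trans_eq ?_
  ring

/-- The step length for a ground set of size `n`. -/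
noncomputable def stepLength (n : ℕ) : ℝ := 1 / (2 * (n : ℝ) ^ 4)

theorem stepExpr_eval {s : State} (h0 : s.nat 0 = n) : stepExpr.eval s = stepLength n := by
  simp only [RealExpr.eval, NatExpr.eval, h0, stepLength]
  push_cast
  ring

theorem halts_moveProg {s : State} (h0 : s.nat 0 = n) :
    Halts f ω moveProg s (120 * (n + 1)) fun s' => Frame {2} {2} s s' ∧
      s'.coins = s.coins ∧ ∀ u : Fin n, s'.real 2 u =
        s.real 2 u + stepLength n * (1 - 2 * s.real 2 u) * s.real 5 u := by
  have key := Halts.forLoop (f := f) (ω := ω) (i := 2) (b := belowSize 2) (N := n) (T := 60)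
    (P := .setReal 2 (.reg 2) (.add (.cell 2 (.reg 2))
      (.mul (.mul stepExpr (.sub (.const 1) (.mul (.const 2) (.cell 2 (.reg 2)))))
        (.cell 5 (.reg 2))))) (s := s)
    (fun k s' => Frame {2} {2} s s' ∧ s'.nat 2 = k ∧ s'.coins = s.coins ∧
      ∀ u : Fin n, s'.real 2 u = if (u : ℕ) < k then
        s.real 2 u + stepLength n * (1 - 2 * s.real 2 u) * s.real 5 u else s.real 2 u)
    ⟨(Frame.refl _ _ s).putNat, by simp⟩
    (fun k _ s' hs' => belowSize_holds ((hs'.1.nat_eq 0).trans h0) hs'.2.1)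
    (fun k hk s' hs' => by
      obtain ⟨hF, h2, hc, hv⟩ := hs'
      refine Halts.mono (Halts.setReal ?_) (by decide) fun _ h => h
      have hδ := stepExpr_eval ((hF.nat_eq 0).trans h0)
      refine ⟨hF.putReal.putNat, by simp [h2], by simp [hc], fun u => ?_⟩
      have he : ∀ e₁ e₂ e₃ : RealExpr, (RealExpr.add e₁ (.mul (.mul stepExpr e₂) e₃)).eval s' =
          e₁.eval s' + stepLength n * e₂.eval s' * e₃.eval s' := fun e₁ e₂ e₃ => by
        rw [← hδ]; rfl
      rw [he]
      simp only [RealExpr.eval, NatExpr.eval, h2, State.putNat_real, State.putReal_real, if_true,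
        Function.update_apply, hF.real_eq 5]
      by_cases huk : (u : ℕ) = k
      · have := hv u
        rw [if_neg (by omega)] at this
        rw [if_pos huk, if_pos (by omega), ← huk, this]
        simp
      · have hlt : (u : ℕ) < k + 1 ↔ (u : ℕ) < k := by omega
        simp only [huk, if_false, hlt, hv u])
  refine key.mono (by omega) fun s' hs' => ⟨hs'.1, hs'.2.2.1, fun u => ?_⟩
  rw [hs'.2.2.2 u, if_pos u.2]

theorem decayExpr_eval {s : State} (h0 : s.nat 0 = n) :
    decayExpr.eval s = s.real 6 0 * (1 - 2 * stepLength n) := by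
  have h1 := stepExpr_eval h0
  have h2 : decayExpr.eval s =
      s.real 6 0 * (((1 : ℚ) : ℝ) - ((2 : ℚ) : ℝ) * stepExpr.eval s) := rfl
  rw [h2, h1]
  push_cast
  rfl

/-- The exponent `k + 1` in `hN` reflects that the program tests the factor it would have after the
next step; no logarithm has to be computed. -/
theorem halts_greedyProg {ε B : ℝ} {p : Fin n → ℝ} {N : ℕ}
    (hN : ∀ k ≤ N, 2 * ε ≤ (1 - 2 * stepLength n) ^ (k + 1) ↔ k < N) :
    Halts f ω greedyProg (initState ε p B) ((N + 1) * (1600 * (n + 1) ^ 8)) fun s' =>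
      s'.output n = greedyPoint f p B n ((n ^ 3) ^ 2) (stepLength n) ω N := by
  have hm : 1 ≤ (n + 1) ^ 8 := Nat.one_le_pow _ _ (Nat.succ_pos n)
  have hm1 : n + 1 ≤ (n + 1) ^ 8 := Nat.le_self_pow (by norm_num) _
  have hm2 : (n + 1) ^ 2 ≤ (n + 1) ^ 8 := Nat.pow_le_pow_right (Nat.succ_pos n) (by norm_num)
  set b := (n ^ 3) ^ 2 * (n * n) with hb
  have key := Halts.loop (f := f) (ω := ω) (N := N) (T := 1500 * (n + 1) ^ 8)
    (b := .realLE (.mul (.const 2) (.cell 0 (.const 1))) decayExpr)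
    (P := .seq estimateProg (.seq knapsackProg (.seq moveProg (.setReal 6 (.const 0) decayExpr))))
    (s := (initState ε p B).putReal 6 0 ((1 : ℚ) : ℝ))
    -- The coin count `k * b` places each iteration on the block of coins that `greedyPoint` reads
    -- in step `k`.
    (fun k s => s.nat 0 = n ∧ s.real 0 0 = B ∧ s.real 0 1 = ε ∧ (∀ u : Fin n, s.real 1 u = p u) ∧
      s.coins = k * b ∧ s.real 6 0 = (1 - 2 * stepLength n) ^ k ∧
      s.output n = greedyPoint f p B n ((n ^ 3) ^ 2) (stepLength n) ω k)
    ⟨by simp [initState], by simp [initState], by simp [initState],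
      fun u => by simp [initState], by simp [initState], by simp,
      by ext u; simp [State.output, initState, greedyPoint]⟩
    (fun k hk s hs => by
      obtain ⟨h0, -, hε, -, -, h6, -⟩ := hs
      rw [← hN k hk, pow_succ, ← h6, ← decayExpr_eval h0]
      have : (Cond.realLE (.mul (.const 2) (.cell 0 (.const 1))) decayExpr).holds s ↔
        ((2 : ℚ) : ℝ) * s.real 0 1 ≤ decayExpr.eval s := Iff.rfl
      rw [this, hε, Rat.cast_ofNat])
    (fun k hk s hs => by
      obtain ⟨h0, hB, hε, hp, hc, h6, hx⟩ := hs
      refine Halts.bind (halts_estimateProg h0) (600 * (n + 1) ^ 8) (by omega) fun s₁ hs₁ => ?_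
      obtain ⟨hF₁, hc₁, hw₁⟩ := hs₁
      have h0₁ : s₁.nat 0 = n := (hF₁.nat_eq 0).trans h0
      refine Halts.bind (halts_knapsackProg (p := p) (B := B) h0₁ (by rw [hF₁.real_eq 0, hB])
        (fun u => by rw [hF₁.real_eq 1, hp])) (180 * (n + 1) ^ 8) (by omega) fun s₂ hs₂ => ?_
      obtain ⟨hF₂, hc₂, hz₂⟩ := hs₂
      have h0₂ : s₂.nat 0 = n := (hF₂.nat_eq 0).trans h0₁
      refine Halts.bind (halts_moveProg h0₂) (60 * (n + 1) ^ 8) (by omega) fun s₃ hs₃ => ?_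
      obtain ⟨hF₃, hc₃, hx₃⟩ := hs₃
      have h0₃ : s₃.nat 0 = n := (hF₃.nat_eq 0).trans h0₂
      refine Halts.mono (Halts.setReal ?_) ((by decide : _ ≤ 60).trans (by omega)) fun _ h => h
      have e0 : s₃.real 0 = s.real 0 := by rw [hF₃.real_eq 0, hF₂.real_eq 0, hF₁.real_eq 0]
      have e1 : s₃.real 1 = s.real 1 := by rw [hF₃.real_eq 1, hF₂.real_eq 1, hF₁.real_eq 1]
      have e6 : s₃.real 6 = s.real 6 := by rw [hF₃.real_eq 6, hF₂.real_eq 6, hF₁.real_eq 6]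
      have e2 : s₂.real 2 = s.real 2 := by rw [hF₂.real_eq 2, hF₁.real_eq 2]
      refine ⟨by simp [h0₃], by simp [e0, hB], by simp [e0, hε], fun u => by simp [e1, hp u], ?_,
        ?_, ?_⟩
      · simp only [State.putReal_coins, hc₃, hc₂, hc₁, hc]; ring
      · rw [decayExpr_eval h0₃]
        simp [NatExpr.eval, e6, h6, pow_succ]
      · ext u
        have hxu : s.real 2 u = greedyPoint f p B n ((n ^ 3) ^ 2) (stepLength n) ω k u :=
          congrFun hx u
        have hw : (fun u : Fin n => s₁.real 4 u) =
            sampledGain f (s.output n) n ((n ^ 3) ^ 2) (shiftTape s.coins ω) := funext hw₁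
        simp only [State.output, State.putReal_real, Nat.reduceEqDiff, if_false, hx₃ u, e2, hz₂ u,
          hw, hxu]
        rw [greedyPoint, ← hx, hc, hb]
        simp only [greedyStep, hx])
  refine (Halts.seq (Halts.setReal key)).mono ?_ fun s' hs' => hs'.2.2.2.2.2.2
  have hcost : (Cond.realLE (.mul (.const 2) (.cell 0 (.const 1))) decayExpr).cost ≤ 50 := by
    decide
  have h1 : N * ((Cond.realLE (.mul (.const 2) (.cell 0 (.const 1))) decayExpr).cost +
      1500 * (n + 1) ^ 8) ≤ N * (1600 * (n + 1) ^ 8) := Nat.mul_le_mul_left _ (by omega)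
  rw [add_mul N 1, one_mul]
  simp only [NatExpr.cost, RealExpr.cost]
  omega

end Correctness

end OracleRAM

/-! ### The theorem -/

open OracleRAM (stepLength)

/-- The error term of the approximation ratio. -/
noncomputable def approxError (n : ℕ) : ℝ := 8 / n + 4 * ((n : ℝ) ^ 3 / 2 ^ n)

theorem tendsto_approxError : Filter.Tendsto approxError Filter.atTop (nhds 0) := by
  have h1 := tendsto_const_div_atTop_nhds_zero_nat (8 : ℝ)
  have h2 := (tendsto_pow_const_div_const_pow_of_one_lt 3
    (by norm_num : (1 : ℝ) < 2)).const_mul 4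
  have h3 := h1.add h2
  rw [mul_zero, add_zero] at h3
  exact h3

theorem one_sub_two_mul_stepLength (n : ℕ) : 1 - 2 * stepLength n = 1 - 1 / (n : ℝ) ^ 4 := by
  unfold stepLength
  rw [one_div, one_div, mul_inv]
  ring

theorem stepLength_mem {n : ℕ} (hn : 1 ≤ n) : 0 ≤ stepLength n ∧ 0 < 2 * stepLength n ∧
    2 * stepLength n ≤ 1 := by
  have hn' : (1 : ℝ) ≤ (n : ℝ) ^ 4 := one_le_pow₀ (by exact_mod_cast hn)
  have h := one_sub_two_mul_stepLength n
  have h1 : 1 / (n : ℝ) ^ 4 ≤ 1 := (div_le_one (by linarith)).2 hn'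
  have h2 : 0 < 1 / (n : ℝ) ^ 4 := by positivity
  refine ⟨?_, ?_, ?_⟩ <;> linarith

/-- The number of steps after which the decay factor is about to fall below `θ`. -/
theorem exists_stepCount {n : ℕ} (hn : 1 ≤ n) {θ : ℝ} (hθ : 0 < θ) (hθ1 : θ ≤ 1) :
    ∃ N : ℕ, (∀ k ≤ N, θ ≤ (1 - 2 * stepLength n) ^ (k + 1) ↔ k < N) ∧
      θ ≤ (1 - 2 * stepLength n) ^ N ∧ N ≤ ⌈-Real.log θ⌉₊ * n ^ 4 := by
  classical
  obtain ⟨-, hδ, hδ'⟩ := stepLength_mem hn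
  set ρ := 1 - 2 * stepLength n with hρ
  have hex : ∃ k : ℕ, ρ ^ (k + 1) < θ := by
    obtain ⟨k, hk⟩ := exists_pow_lt_of_lt_one hθ (by linarith : ρ < 1)
    exact ⟨k, (pow_le_pow_of_le_one (by linarith) (by linarith) (Nat.le_succ k)).trans_lt hk⟩
  have hN : θ ≤ ρ ^ Nat.find hex := by
    rcases Nat.eq_zero_or_pos (Nat.find hex) with h | h
    · rw [h, pow_zero]; exact hθ1
    · have := Nat.find_min hex (Nat.sub_lt h one_pos)
      rwa [not_lt, Nat.sub_one_add_one h.ne'] at this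
  refine ⟨Nat.find hex, fun k hk => ⟨fun h => ?_, fun h => not_lt.1 (Nat.find_min hex h)⟩, hN, ?_⟩
  · refine lt_of_le_of_ne hk fun e => ?_
    have := Nat.find_spec hex
    rw [← e] at this
    exact absurd this (not_lt.2 h)
  · have hn4 : (0 : ℝ) < (n : ℝ) ^ 4 := pow_pos (by exact_mod_cast hn) 4
    -- Since `ρ = 1 - 1 / n ^ 4 ≤ exp (-1 / n ^ 4)`, the bound `θ ≤ ρ ^ N` forces `N ≤ -log θ * n ^
    -- 4`.
    have h1 : ρ ≤ Real.exp (-(1 / (n : ℝ) ^ 4)) := by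
      rw [hρ, one_sub_two_mul_stepLength]
      linarith [Real.add_one_le_exp (-(1 / (n : ℝ) ^ 4))]
    have h2 : θ ≤ Real.exp ((Nat.find hex : ℕ) * -(1 / (n : ℝ) ^ 4)) := by
      rw [Real.exp_nat_mul]
      exact hN.trans (pow_le_pow_left₀ (by linarith) h1 _)
    have h3 := (Real.log_le_iff_le_exp hθ).2 h2
    have h4 : ((Nat.find hex : ℕ) : ℝ) ≤ -Real.log θ * (n : ℝ) ^ 4 := by
      rw [← div_le_iff₀ hn4, div_eq_mul_one_div]
      linarith
    have h5 := mul_le_mul_of_nonneg_right (Nat.le_ceil (-Real.log θ)) hn4.le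
    exact_mod_cast h4.trans h5

/-- With these parameters the loss is `3 / n + 4 * n ^ 3 / 2 ^ n`; stopping one step before the
factor passes `2 * ε` costs at most `1 / n` more. -/
theorem ratio_le {n : ℕ} (hn : 1 ≤ n) {ε : ℝ} {N : ℕ}
    (hN : (1 - 2 * stepLength n) ^ (N + 1) < 2 * ε) :
    1 / 2 - ε - approxError n ≤
      (1 - stepLoss n (n ^ 3) n n (stepLength n)) / 2 * (1 - (1 - 2 * stepLength n) ^ N) := by
  obtain ⟨-, hδ, hδ'⟩ := stepLength_mem hn
  have hn1 : (1 : ℝ) ≤ n := by exact_mod_cast hn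
  have hn0 : (0 : ℝ) < n := by linarith
  have hη : stepLoss n (n ^ 3) n n (stepLength n) = 3 / n + 4 * ((n : ℝ) ^ 3 / 2 ^ n) := by
    unfold stepLoss stepLength
    push_cast
    rw [one_div_pow]
    field_simp
    ring
  have hρ := one_sub_two_mul_stepLength n
  rw [hη]
  unfold approxError
  set ρ := 1 - 2 * stepLength n
  set t := 4 * ((n : ℝ) ^ 3 / 2 ^ n) with ht
  have ht0 : 0 ≤ t := by positivity
  have hρN0 : 0 ≤ ρ ^ N := pow_nonneg (by linarith) N
  have hρN1 : ρ ^ N ≤ 1 := pow_le_one₀ (by linarith) (by linarith)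
  have h4 : 1 / (n : ℝ) ^ 4 ≤ 1 / n :=
    one_div_le_one_div_of_le hn0 (le_self_pow₀ hn1 (by norm_num))
  have h5 : ρ ^ N ≤ 2 * ε + 1 / n := by
    have e : ρ ^ N = ρ ^ (N + 1) + ρ ^ N * (1 / (n : ℝ) ^ 4) := by rw [pow_succ, hρ]; ring
    have : ρ ^ N * (1 / (n : ℝ) ^ 4) ≤ 1 / n :=
      (mul_le_of_le_one_left (by positivity) hρN1).trans h4
    linarith
  have h6 : (3 / n + t) * (1 - ρ ^ N) ≤ 3 / n + t :=
    mul_le_of_le_one_right (by positivity) (by linarith)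
  have h7 : 8 / (n : ℝ) = 8 * (1 / n) := by ring
  have h8 : 3 / (n : ℝ) = 3 * (1 / n) := by ring
  have h9 : 0 < 1 / (n : ℝ) := by positivity
  rw [h8] at h6 ⊢
  rw [h7]
  linarith

theorem mainTheorem7 (ε : ℝ) (hε : 0 < ε) (hε' : ε ≤ 1 / 2) :
    ∃ (A : OracleRAM.Prog) (time : Polynomial ℕ) (err : ℕ → ℝ),
      Filter.Tendsto err Filter.atTop (nhds 0) ∧
      ∀ (n : ℕ) (f : Finset (Fin n) → ℝ) (p : Fin n → ℝ) (B : ℝ),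
        (∀ S, 0 ≤ f S) → IsSubmodular f → IsSymmetricSetFun f →
        (∀ u, 0 ≤ p u) → 0 < density p B → density p B < 1 →
        ∃ x : (Fin (time.eval n) → Bool) → Fin n → ℝ,
          OracleRAM.RunsWithin A ε f p B (time.eval n) x ∧
          (∀ r, x r ∈ bicriteriaFeasible (knapsackPolytope p B)
            ((1 - (2 * ε) ^ density p B) / (2 * density p B))) ∧
          ∀ O : Finset (Fin n), IsIntegralOpt f (knapsackPolytope p B) O →
            (1 / 2 - ε - err n) * f O ≤ 𝔼 r, multilinearExt f (x r) := by
  set c := ⌈-Real.log (2 * ε)⌉₊ with hc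
  -- The exponent `12` is `8` for one iteration plus `4` for the number of iterations, at most `c *
  -- n ^ 4`.
  refine ⟨OracleRAM.greedyProg,
    Polynomial.C (1600 * (c + 1)) * (Polynomial.X + 1) ^ 12, approxError, tendsto_approxError,
    fun n f p B h0 hf hsym hp hd hd1 => ?_⟩
  have htime : (Polynomial.C (1600 * (c + 1)) * (Polynomial.X + 1) ^ 12).eval n =
      1600 * (c + 1) * (n + 1) ^ 12 := by simp
  rw [htime]
  -- On an empty ground set the density is a quotient by zero, hence zero.
  have hn : 1 ≤ n := by
    by_contra hn
    obtain rfl : n = 0 := by omega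
    simp [density] at hd
  obtain ⟨hδ, -, hδ'⟩ := stepLength_mem hn
  obtain ⟨N, hN, hθN, hNc⟩ := exists_stepCount hn (θ := 2 * ε) (by linarith) (by linarith)
  rw [← hc] at hNc
  have hN' : N + 1 ≤ (c + 1) * (n + 1) ^ 4 := by
    have h1 : n ^ 4 ≤ (n + 1) ^ 4 := Nat.pow_le_pow_left (Nat.le_succ n) 4
    have h2 : 1 ≤ (n + 1) ^ 4 := Nat.one_le_pow _ _ (Nat.succ_pos n)
    have h3 := Nat.mul_le_mul_left c h1
    rw [add_mul, one_mul]
    omega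
  refine ⟨fun r => greedyPoint f p B n ((n ^ 3) ^ 2) (stepLength n) (OracleRAM.tape r) N,
    fun r => ?_, fun r => ?_, fun O hO => ?_⟩
  · obtain ⟨t, ht, s, he, hs⟩ := OracleRAM.halts_greedyProg (f := f) (ω := OracleRAM.tape r)
      (p := p) (B := B) hN
    refine ⟨t, ht.trans ((Nat.mul_le_mul_right _ hN').trans_eq ?_), s, he, hs⟩
    ring
  · exact greedyPoint_mem_bicriteriaFeasible hp hd hd1 (by linarith) (by linarith) hδ hδ' _ _ hθN
  -- The coins used by all steps fit on the tape whose length is the time bound.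
  · have hm : N * ((n ^ 3) ^ 2 * (n * n)) ≤ 1600 * (c + 1) * (n + 1) ^ 12 := by
      have h1 : (n ^ 3) ^ 2 * (n * n) ≤ (n + 1) ^ 8 :=
        (by ring : (n ^ 3) ^ 2 * (n * n) = n ^ 8).le.trans
          (Nat.pow_le_pow_left (Nat.le_succ n) 8)
      have h2 := Nat.mul_le_mul ((Nat.le_succ N).trans hN') h1
      have h3 : (c + 1) * (n + 1) ^ 4 * (n + 1) ^ 8 = (c + 1) * (n + 1) ^ 12 := by ring
      rw [h3] at h2
      rw [mul_assoc]
      omega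
    have hlt : (1 - 2 * stepLength n) ^ (N + 1) < 2 * ε :=
      not_le.1 fun h => lt_irrefl N ((hN N le_rfl).1 h)
    refine (mul_le_mul_of_nonneg_right (ratio_le hn hlt) (h0 O)).trans ?_
    exact coinAvg_greedyPoint_ge_of_isIntegralOpt hn (pow_pos hn 3) hδ hδ' h0 hf hsym hp hO N hm
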